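/- **Setting.** Let $E/\mathbb{Q}$ be an elliptic curve given by a global minimal Weierstrass equation $y^2+a_1xy+a_3y=x^3+a_2x^2+a_4x+a_6$ over $\mathbb{Z}$, and let $p$ be an odd prime of good ordinary reduction. Let $K$ be an imaginary quadratic field with class number $h$ and complex conjugation $c$, in which $p$ splits as $p\mathcal{O}_K=\pi\pi^c$ with $\pi\neq\pi^c$. Fix an isomorphism of valued fields $\psi:K_\pi\to\mathbb{Q}_p$. * $\log_p:\mathbb{Q}_p^\times\to\mathbb{Q}_p$ is the homomorphism with $\log_p(p)=0$ that extends the usual logarithm series on $1+p\mathbb{Z}_p$. * $\rho:\mathbb{A}_K^\times/K^\times\to\mathbb{Q}_p$ is the anticyclotomic idele class character $\rho((x_v)_v)=\frac{1}{hp}\log_p\psi\left(\frac{\alpha x_\pi^h}{\alpha^c (x_{\pi^c}^{c})^{h}}\right)$, where $\alpha\in K^\times$ is any element with $\alpha x_v^h\in\mathcal{O}_v^\times$ for all finite $v$. For a finite place $w$, $\rho_w$ is the composition of $\rho$ with the inclusion $K_w^\times\hookrightarrow\mathbb{A}_K^\times$. * $\sigma_p(t)=t+\cdots\in t\mathbb{Z}_p[[t]]$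 is the $p$-adic sigma function of $E$: the unique odd power series in the parameter $t=-x/y$ for which there is a constant $e\in\mathbb{Z}_p$ with $x(t)+e=-\frac{d}{\omega}\left(\frac1{\sigma_p}\frac{d\sigma_p}{\omega}\right)$, where $\omega=\frac{dx}{2y+a_1x+a_3}$. For $v\in\{\pi,\pi^c\}$ and a point $Q$ that reduces to $0$ modulo $v$, $\sigma_v(Q)\in K_v$ is the value of $\sigma_p$ at $t(Q)$, where $K_v$ is identified with $\mathbb{Q}_p$ (by $\psi$ if $v=\pi$, and by $\psi\circ c$ if $v=\pi^c$). * For a finite place $w$ and $0\ne Q\in E(K)$, $d_w(Q)\in\mathcal{O}_w$ is a local denominator: $x(Q)=a/d_w(Q)^2$ and $y(Q)=b/d_w(Q)^3$ in $K_w$ with $a,b\in\mathcal{O}_w$ each relatively prime to $d_w(Q)$. * Call $0\neq Q\in E(K)$ admissible if it reduces to $0$ modulo the primes above $p$ and to the identity component of every special fibre of the Néron model of $E$ over $\mathcal{O}_K$. The anticyclotomic $p$-adic height $h_\rho:E(K)\to\mathbb{Q}_p$ is given on admissible points by $$h_\rho(Q)=\sum_{v\mid p}\rho_v(\sigma_v(Q))+\sum_{w\nmid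 p\infty}\rho_w(d_w(Q)),$$ and is extended to $E(K)$ by $h_\rho(mQ)=m^2h_\rho(Q)$ (with $h_\rho=0$ on torsion points). * For $0\neq Q\in E(K)$ let $\delta(Q)\subset\mathcal{O}_K$ be the denominator ideal of $x(Q)\mathcal{O}_K$, all of whose prime exponents are even, and let $\mathbf{d}_h(Q)\in\mathcal{O}_K$ be any generator of the principal ideal $\prod_{\mathfrak{q}}\mathfrak{q}^{h\,\mathrm{ord}_{\mathfrak{q}}(\delta(Q))/2}$, the product being over the nonzero prime ideals of $\mathcal{O}_K$. **Proposition.** Let $P\in E(K)$ be a non-torsion point which reduces to $0$ modulo the primes above $p$ and to the identity component of every special fibre of the Néron model of $E$. Then $$h_\rho(P)=\frac1p\log_p\left(\psi\left(\frac{\sigma_\pi(P)}{\sigma_\pi(P^c)}\right)\right)+\frac1{hp}\log_p\left(\psi\left(\frac{\mathbf{d}_h(P)^c}{\mathbf{d}_h(P)}\right)\right).$$ -/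

import Mathlib

open IsDedekindDomain NumberField WeierstrassCurve
open scoped LaurentSeries PowerSeries

noncomputable section

namespace AnticycHeight

/-! ### The `p`-adic logarithm -/

section Logarithm

variable (p : ℕ) [Fact p.Prime]

/-- The series `∑ (-1)^n (u - 1)^(n+1) / (n+1)`, i.e. the logarithm on `1 + pℤ_p`. -/
def logSeries (u : ℚ_[p]) : ℚ_[p] :=
  ∑' n : ℕ, (-1) ^ n * (u - 1) ^ (n + 1) / ((n : ℚ_[p]) + 1)

/-- The `p`-adic logarithm `log_p : ℚ_p^× → ℚ_p`, normalised by `log_p p = 0`: for `x = p ^ m * u`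
with `u` a unit, `log_p x = (p - 1)⁻¹ log_p (u ^ (p - 1))`, where `u ^ (p - 1) ∈ 1 + pℤ_p`.
(Its value at `0` is irrelevant.) -/
def padicLog (x : ℚ_[p]) : ℚ_[p] :=
  ((p : ℚ_[p]) - 1)⁻¹ * logSeries p ((x * (p : ℚ_[p]) ^ (-x.valuation)) ^ (p - 1))

end Logarithm

/-! ### Complex conjugation on primes and completions -/

section Conjugation

variable {K : Type*} [Field K] [NumberField K] (c : K ≃ₐ[ℚ] K)

/-- The prime `c⁻¹(v)` of `K`. When `c` is complex conjugation of an imaginary quadratic field,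
this is the conjugate prime `v^c = c(v)`. -/
def conjPrime (v : HeightOneSpectrum (𝓞 K)) : HeightOneSpectrum (𝓞 K) :=
  HeightOneSpectrum.comap (RingOfIntegers.mapRingEquiv c.toRingEquiv : 𝓞 K →+* 𝓞 K)
    (RingOfIntegers.mapRingEquiv c.toRingEquiv).surjective v

theorem intValuation_conjPrime (v : HeightOneSpectrum (𝓞 K)) (r : 𝓞 K) :
    v.intValuation (RingOfIntegers.mapRingEquiv c.toRingEquiv r) =
      (conjPrime c v).intValuation r := by
  set e := RingOfIntegers.mapRingEquiv c.toRingEquiv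
  have key : ∀ n : ℕ, v.intValuation (e r) ≤ WithZero.exp (-(n : ℤ)) ↔
      (conjPrime c v).intValuation r ≤ WithZero.exp (-(n : ℤ)) := by
    intro n
    rw [HeightOneSpectrum.intValuation_le_pow_iff_mem,
      HeightOneSpectrum.intValuation_le_pow_iff_mem]
    have h1 : (conjPrime c v).asIdeal = v.asIdeal.map (e.symm : 𝓞 K →+* 𝓞 K) := by
      simp only [conjPrime]
      exact (Ideal.map_symm e).symm
    rw [h1, ← Ideal.map_pow]
    erw [Ideal.map_symm e]
    rfl
  by_cases hr : r = 0
  · simp [hr]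
  have her : e r ≠ 0 := by simpa using hr
  rw [HeightOneSpectrum.intValuation_if_neg _ her,
    HeightOneSpectrum.intValuation_if_neg _ hr] at key ⊢
  simp only [WithZero.exp_le_exp, neg_le_neg_iff, Nat.cast_le] at key
  congr 3
  exact le_antisymm ((key _).1 le_rfl) ((key _).2 le_rfl)

theorem valuation_conjPrime (v : HeightOneSpectrum (𝓞 K)) (x : K) :
    v.valuation K (c x) = (conjPrime c v).valuation K x := by
  obtain ⟨a, b, hb, rfl⟩ := IsFractionRing.div_surjective (A := 𝓞 K) x
  have h : ∀ r : 𝓞 K, c (algebraMap (𝓞 K) K r) =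
    algebraMap (𝓞 K) K (RingOfIntegers.mapRingEquiv c.toRingEquiv r) := fun r => rfl
  simp only [map_div₀, h, HeightOneSpectrum.valuation_of_algebraMap, intValuation_conjPrime]

theorem continuous_congr_of_valuation {v w : HeightOneSpectrum (𝓞 K)} (e : K ≃+* K)
    (h : ∀ x, v.valuation K (e x) = w.valuation K x) :
    Continuous (WithVal.congr (w.valuation K) (v.valuation K) e) := by
  refine continuous_of_continuousAt_zero (WithVal.congr (w.valuation K) (v.valuation K) e) ?_
  rw [ContinuousAt, map_zero, (Valued.hasBasis_nhds_zero _ _).tendsto_iff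
    (Valued.hasBasis_nhds_zero _ _)]
  intro γ _
  obtain ⟨z, hz⟩ := MonoidWithZeroHom.ValueGroup₀.restrict₀_surjective _ γ.val
  set z' := (WithVal.congr (w.valuation K) (v.valuation K) e).symm z
  have hv : ∀ x, Valued.v (WithVal.congr (w.valuation K) (v.valuation K) e x) = Valued.v x :=
    fun x => h x.ofVal
  have hzz : WithVal.congr (w.valuation K) (v.valuation K) e z' = z := by simp [z']
  have hz0 : z ≠ 0 := by
    rintro rfl
    exact γ.ne_zero (by rw [← hz]; simp)
  have hz'0 : Valued.v.restrict z' ≠ 0 := by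
    have : z' ≠ 0 := by
      intro h0
      exact hz0 (by rw [← hzz, h0, map_zero])
    simpa using this
  refine ⟨Units.mk0 _ hz'0, trivial, fun x hx => ?_⟩
  have hx' : Valued.v.restrict x < Valued.v.restrict z' := hx
  rw [Valuation.restrict_lt_iff, ← hv, ← hv, hzz] at hx'
  change Valued.v.restrict _ < γ.val
  rw [← hz]
  exact (Valuation.restrict_lt_iff _).2 hx'

/-- The isomorphism of completions `K_{v^c} ≃ K_v` that extends `c : K → K` by continuity. -/
def conjCompletion (v : HeightOneSpectrum (𝓞 K)) :
    (conjPrime c v).adicCompletion K ≃+* v.adicCompletion K :=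
  ((HeightOneSpectrum.adicCompletion.equiv K (conjPrime c v)).trans
    (UniformSpace.Completion.mapRingEquiv
      (WithVal.congr ((conjPrime c v).valuation K) (v.valuation K) c.toRingEquiv)
      (continuous_congr_of_valuation _ (valuation_conjPrime c v))
      (continuous_congr_of_valuation c.symm.toRingEquiv fun x => by
        rw [← valuation_conjPrime]; simp))).trans
    (HeightOneSpectrum.adicCompletion.equiv K v).symm

theorem conjCompletion_coe (v : HeightOneSpectrum (𝓞 K)) (x : K) :
    conjCompletion c v (x : (conjPrime c v).adicCompletion K) = (c x : v.adicCompletion K) := by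
  refine HeightOneSpectrum.adicCompletion.ext K v ?_
  exact UniformSpace.Completion.mapRingHom_coe
    (continuous_congr_of_valuation c.toRingEquiv (valuation_conjPrime c v))
    (WithVal.toVal ((conjPrime c v).valuation K) x)

end Conjugation

/-! ### The anticyclotomic idele class character -/

section Character

variable {K : Type*} [Field K] [NumberField K]

open Classical in
/-- The inclusion `K_w → 𝔸_K` of multiplicative monoids: `x` at the place `w`, and `1` at all other
places, including the archimedean ones. -/
def placeInclusion (w : HeightOneSpectrum (𝓞 K)) :
    w.adicCompletion K →* AdeleRing (𝓞 K) K where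
  toFun x := (1, ⟨Pi.mulSingle w x, by
    filter_upwards [(Set.finite_singleton w).compl_mem_cofinite] with v hv
    rw [Pi.mulSingle_eq_of_ne (by simpa using hv)]
    exact one_mem _⟩)
  map_one' := Prod.ext rfl (Subtype.ext (Pi.mulSingle_one w))
  map_mul' x y := Prod.ext (one_mul 1).symm (Subtype.ext (Pi.mulSingle_mul w x y))

open Classical in
/-- The local component `ρ_w = ρ ∘ ι_w` of a function `ρ` on the ideles of `K`, where
`ι_w : K_w^× → 𝔸_K^×` is the natural inclusion. (The value at `0 ∈ K_w` is irrelevant.) -/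
def localComponent {A : Type*} [Zero A] (ρ : (AdeleRing (𝓞 K) K)ˣ → A)
    (w : HeightOneSpectrum (𝓞 K)) (x : w.adicCompletion K) : A :=
  if hx : x ≠ 0 then ρ (Units.map (placeInclusion w) (Units.mk0 x hx)) else 0

/-- `α ∈ K^×` is such that `α x_v ^ h ∈ 𝒪_v^×` for all finite places `v`, where `h` is the class
number of `K`. -/
def Trivializes (x : (AdeleRing (𝓞 K) K)ˣ) (α : Kˣ) : Prop :=
  ∀ v : HeightOneSpectrum (𝓞 K),
    Valued.v (((α : K) : v.adicCompletion K) *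
      ((x : AdeleRing (𝓞 K) K).2 v) ^ classNumber K) = 1

open Classical in
/-- The anticyclotomic `p`-adic idele class character attached to `π` and `ψ : K_π ≃ ℚ_p`,
`ρ(x) = (hp)⁻¹ log_p ψ (α x_π ^ h / (α^c (x_{π^c})^{ch}))`, where `α ∈ K^×` is any element with
`α x_v ^ h ∈ 𝒪_v^×` for all finite places `v`. Such an `α` exists because `h`-th powers of ideals
are principal. -/
def anticycChar (p : ℕ) [Fact p.Prime] (c : K ≃ₐ[ℚ] K) (π : HeightOneSpectrum (𝓞 K))
    (ψ : π.adicCompletion K ≃+* ℚ_[p]) (x : (AdeleRing (𝓞 K) K)ˣ) : ℚ_[p] :=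
  if hα : ∃ α : Kˣ, Trivializes x α then
    1 / ((classNumber K : ℚ_[p]) * p) * padicLog p (ψ (
      (((hα.choose : K) : π.adicCompletion K) *
        ((x : AdeleRing (𝓞 K) K).2 π) ^ classNumber K) /
      (((c (hα.choose : K) : K) : π.adicCompletion K) *
        (conjCompletion c π ((x : AdeleRing (𝓞 K) K).2 (conjPrime c π))) ^ classNumber K)))
  else 0

end Character

/-! ### Elliptic curves over `ℚ` and the `p`-adic sigma function -/

section Sigma

variable (W : WeierstrassCurve ℤ) (p : ℕ) [Fact p.Prime]

/-- `W` is a global minimal Weierstrass equation of an elliptic curve over `ℚ`. -/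
structure IsGlobalMinimal : Prop where
  isElliptic : (W⁄ℚ).IsElliptic
  isMinimal : ∀ (ℓ : ℕ) [Fact ℓ.Prime], IsMinimal ℤ_[ℓ] (W⁄ℚ_[ℓ])

/-- `E` has good ordinary reduction at `p`: `p ∤ Δ`, and `p ∤ a_p = p + 1 - #E(𝔽_p)`. -/
structure IsGoodOrdinary : Prop where
  good : ¬ (p : ℤ) ∣ W.Δ
  ordinary : ¬ (p : ℤ) ∣ (p + 1 - Nat.card (W⁄(ZMod p)).toAffine.Point : ℤ)

/-- A power series over `ℤ_p` viewed as a Laurent series over `ℚ_p`. -/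
def toLaurent (f : ℤ_[p]⟦X⟧) : ℚ_[p]⸨X⸩ :=
  ((f.map (algebraMap ℤ_[p] ℚ_[p]) : ℚ_[p]⟦X⟧) : ℚ_[p]⸨X⸩)

/-- The derivation `f ↦ df / ω` of the field of Laurent series in the parameter `t = -x/y`, where
`ω = dx / (2y + a₁x + a₃)` is the invariant differential; here `x`, `y` are the expansions of the
coordinate functions. -/
def invDerivation (x y f : ℚ_[p]⸨X⸩) : ℚ_[p]⸨X⸩ :=
  (2 * y + (W.a₁ : ℚ_[p]⸨X⸩) * x + (W.a₃ : ℚ_[p]⸨X⸩)) *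
    LaurentSeries.derivative ℚ_[p] f / LaurentSeries.derivative ℚ_[p] x

/-- `x`, `y` are the Laurent expansions, in the parameter `t = -x/y` at the origin, of the
coordinate functions: `(x(t), y(t))` lies on the curve, `-x(t)/y(t) = t`, and `x(t)` has a pole at
`t = 0`. -/
structure IsCoordinateExpansion (x y : ℚ_[p]⸨X⸩) : Prop where
  equation : (W⁄(ℚ_[p]⸨X⸩)).toAffine.Equation x y
  param : x = -((PowerSeries.X : ℚ_[p]⟦X⟧) : ℚ_[p]⸨X⸩) * y
  pole : x.order < 0

/-- `σ` is the (Mazur-Tate) `p`-adic sigma function of `W`: the odd power series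
`σ(t) = t + ⋯ ∈ tℤ_p⟦t⟧` such that `x(t) + e = -(d/ω)(σ⁻¹ dσ/ω)` for some constant `e ∈ ℤ_p`.
Oddness means `σ(i(t)) = -σ(t)`, where `i(t) = x(t) / (y(t) + a₁ x(t) + a₃)` is the parameter of
the inverse point. If `W` has good ordinary reduction at the odd prime `p`, these conditions
determine `σ`. -/
def IsPadicSigma (σ : ℤ_[p]⟦X⟧) : Prop :=
  PowerSeries.constantCoeff σ = 0 ∧ PowerSeries.coeff 1 σ = 1 ∧
  ∃ (x y : ℚ_[p]⸨X⸩) (i : ℤ_[p]⟦X⟧) (e : ℤ_[p]),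
    IsCoordinateExpansion W p x y ∧
    toLaurent p i = x / (y + (W.a₁ : ℚ_[p]⸨X⸩) * x + (W.a₃ : ℚ_[p]⸨X⸩)) ∧
    PowerSeries.subst i σ = -σ ∧
    x + toLaurent p (PowerSeries.C e) =
      -invDerivation W p x y (invDerivation W p x y (toLaurent p σ) / toLaurent p σ)

open Classical in
/-- The `p`-adic sigma function of `W`. (By a theorem of Mazur and Tate it exists for good ordinary
reduction; the value in the other case is irrelevant.) -/
def padicSigma : ℤ_[p]⟦X⟧ :=
  if h : ∃ σ, IsPadicSigma W p σ then h.choose else PowerSeries.X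

/-- The value `σ_p(t)` for `t ∈ pℤ_p`. -/
def sigmaEval (t : ℚ_[p]) : ℚ_[p] :=
  ∑' n : ℕ, ((PowerSeries.coeff n (padicSigma W p) : ℤ_[p]) : ℚ_[p]) * t ^ n

end Sigma

/-! ### Points -/

section Points

variable {K : Type*} [Field K] {W : WeierstrassCurve ℤ}

/-- The `x`-coordinate of a point. (Its value at the origin is irrelevant.) -/
def xCoord (P : (W⁄K).toAffine.Point) : K :=
  match P with
  | .zero => 0
  | .some x _ _ => x

/-- The `y`-coordinate of a point. (Its value at the origin is irrelevant.) -/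
def yCoord (P : (W⁄K).toAffine.Point) : K :=
  match P with
  | .zero => 0
  | .some _ y _ => y

variable [NumberField K]

/-- The conjugate point `P^c`. -/
def conjPoint [DecidableEq K] (c : K ≃ₐ[ℚ] K) (P : (W⁄K).toAffine.Point) : (W⁄K).toAffine.Point :=
  Affine.Point.map (S := ℚ) (c : K →ₐ[ℚ] K) P

/-- `P` reduces to the origin modulo `v`. (The Weierstrass equation `W` is integral.) -/
def ReducesToZero (v : HeightOneSpectrum (𝓞 K)) (P : (W⁄K).toAffine.Point) : Prop :=
  P ≠ 0 → 1 < v.valuation K (xCoord P)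

/-- `P` reduces to the identity component of the special fibre at `w` of the Néron model of `E`
over `𝒪_K`: on a minimal Weierstrass equation `C • W` over `𝒪_w`, the point `P`, of coordinates
`(X, Y)`, reduces to a nonsingular point, i.e. to the origin or to a point at which one of the
partial derivatives of the equation does not vanish. The coordinates of the two equations are
related by `x = u²X + r` and `y = u³Y + u²sX + t`. -/
def ReducesToIdentityComponent (w : HeightOneSpectrum (𝓞 K)) (P : (W⁄K).toAffine.Point) : Prop :=
  P ≠ 0 → ∃ C : VariableChange (w.adicCompletion K),
    IsMinimal (w.adicCompletionIntegers K) (C • (W⁄(w.adicCompletion K))) ∧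
    ∃ X Y : w.adicCompletion K,
      ((xCoord P : K) : w.adicCompletion K) = C.u ^ 2 * X + C.r ∧
      ((yCoord P : K) : w.adicCompletion K) = C.u ^ 3 * Y + C.u ^ 2 * C.s * X + C.t ∧
      (1 < Valued.v X ∨
        Valued.v ((C • (W⁄(w.adicCompletion K))).toAffine.polynomialX.evalEval X Y) = 1 ∨
        Valued.v ((C • (W⁄(w.adicCompletion K))).toAffine.polynomialY.evalEval X Y) = 1)

/-- `d` is a local denominator of `P` at `w`: `(x, y) = (a / d², b / d³)` in `K_w`, where
`a, b, d ∈ 𝒪_w` and `a`, `b` are each relatively prime to `d ≠ 0`. -/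
def IsLocalDenominator (w : HeightOneSpectrum (𝓞 K)) (P : (W⁄K).toAffine.Point)
    (d : w.adicCompletionIntegers K) : Prop :=
  d ≠ 0 ∧ ∃ a b : w.adicCompletionIntegers K, IsCoprime a d ∧ IsCoprime b d ∧
    ((xCoord P : K) : w.adicCompletion K) = (a : w.adicCompletion K) / (d : w.adicCompletion K) ^ 2 ∧
    ((yCoord P : K) : w.adicCompletion K) = (b : w.adicCompletion K) / (d : w.adicCompletion K) ^ 3

open Classical in
/-- A local denominator `d_w(P)` of `P ≠ 0` at `w`; it is unique up to a unit. -/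
def localDenominator (w : HeightOneSpectrum (𝓞 K)) (P : (W⁄K).toAffine.Point) :
    w.adicCompletion K :=
  if h : ∃ d : w.adicCompletionIntegers K, IsLocalDenominator w P d then
    (h.choose : w.adicCompletion K) else 1

/-- The value `σ_v(P) ∈ K_v` at a point `P` that reduces to `0` modulo a prime `v ∣ p` of degree
one, where `φ` is the isomorphism `K_v ≃ ℚ_p`. Since `E` is defined over `ℚ`, the `v`-adic sigma
function is the `p`-adic sigma function, evaluated at the parameter `t = -x/y` of `P`. -/
def sigmaAt {p : ℕ} [Fact p.Prime] {v : HeightOneSpectrum (𝓞 K)}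
    (φ : v.adicCompletion K ≃+* ℚ_[p]) (P : (W⁄K).toAffine.Point) : v.adicCompletion K :=
  φ.symm (sigmaEval W p (φ ((-xCoord P / yCoord P : K) : v.adicCompletion K)))

/-- The denominator ideal `{r ∈ 𝒪_K | r x ∈ 𝒪_K}` of `x 𝒪_K`. -/
def denominatorIdeal (x : K) : Ideal (𝓞 K) where
  carrier := {r | ∃ s : 𝓞 K, (r : K) * x = s}
  zero_mem' := ⟨0, by simp⟩
  add_mem' := by
    rintro r r' ⟨s, hs⟩ ⟨s', hs'⟩
    exact ⟨s + s', by push_cast; rw [add_mul, hs, hs']⟩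
  smul_mem' := by
    rintro a r ⟨s, hs⟩
    exact ⟨a * s, by rw [smul_eq_mul]; push_cast; rw [mul_assoc, hs]⟩

open Classical in
/-- `d` generates the ideal `∏ 𝔮 ^ (h ord_𝔮(δ(P)) / 2)`, where `δ(P)` is the denominator ideal of
`x(P)` and `h` is the class number of `K`. -/
def IsGlobalDenominator (P : (W⁄K).toAffine.Point) (d : 𝓞 K) : Prop :=
  Ideal.span {d} = ∏ᶠ q : HeightOneSpectrum (𝓞 K), q.asIdeal ^
    (classNumber K *
      (Associates.mk q.asIdeal).count (Associates.mk (denominatorIdeal (xCoord P))).factors / 2)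

end Points

/-! ### The height -/

section Height

variable {K : Type*} [Field K] [NumberField K] {W : WeierstrassCurve ℤ}
variable {p : ℕ} [Fact p.Prime] (c : K ≃ₐ[ℚ] K) {π : HeightOneSpectrum (𝓞 K)}
variable (ψ : π.adicCompletion K ≃+* ℚ_[p])

/-- `Q` is nonzero, reduces to `0` modulo all primes above `p`, and to the identity component of
every special fibre of the Néron model. -/
def IsAdmissible (p : ℕ) (Q : (W⁄K).toAffine.Point) : Prop :=
  Q ≠ 0 ∧ (∀ v : HeightOneSpectrum (𝓞 K), (p : 𝓞 K) ∈ v.asIdeal → ReducesToZero v Q) ∧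
    ∀ w : HeightOneSpectrum (𝓞 K), ReducesToIdentityComponent w Q

/-- For a function `ρ` on the ideles, the sum of local heights
`∑_{v ∣ p} ρ_v(σ_v(Q)) + ∑_{w ∤ p∞} ρ_w(d_w(Q))`. The primes above `p` are `π`, with `K_π ≃ ℚ_p`
given by `ψ`, and `π^c`, with `K_{π^c} ≃ ℚ_p` given by `ψ ∘ c`. -/
def localHeightSum (ρ : (AdeleRing (𝓞 K) K)ˣ → ℚ_[p]) (Q : (W⁄K).toAffine.Point) : ℚ_[p] :=
  localComponent ρ π (sigmaAt ψ Q) +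
  localComponent ρ (conjPrime c π) (sigmaAt ((conjCompletion c π).trans ψ) Q) +
  ∑ᶠ w : {w : HeightOneSpectrum (𝓞 K) // (p : 𝓞 K) ∉ w.asIdeal},
    localComponent ρ w.1 (localDenominator w.1 Q)

open Classical in
/-- The `ρ`-height `h_ρ` on `E(K)`: it is given by the sum of local heights on the points `Q ≠ 0`
that reduce to `0` modulo the primes above `p` and to the identity component of every special
fibre of the Néron model, and is extended to all of `E(K)` by `h_ρ(mP) = m² h_ρ(P)`. Every
nontorsion point has such a multiple (we take the least one), and torsion points have height `0`. -/
def rhoHeight [DecidableEq K] (ρ : (AdeleRing (𝓞 K) K)ˣ → ℚ_[p]) (P : (W⁄K).toAffine.Point) : ℚ_[p] :=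
  if h : ∃ m : ℕ, 0 < m ∧ IsAdmissible p (m • P) then
    1 / (Nat.find h : ℚ_[p]) ^ 2 * localHeightSum c ψ ρ (Nat.find h • P)
  else 0

end Height

end AnticycHeight

end

/-!
The identity holds because the character `ρ` sees an idele only through a generator of the `h`-th
power of its ideal. Since `P` is itself admissible, `h_ρ(P)` is the sum of local heights of `P`.
For each finite place `w` choose `α_w ∈ K^×` that trivialises the local term at `w`: it generates
`w ^ (-h k_w)`, where `w ^ k_w` is the `w`-part of the denominator of `P`; at the places above `p`
this uses that `σ_v(P)` has the same valuation as `x(P) / y(P)` (`norm_sigmaEval`), the `p`-adic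
valuation of a local denominator (`valued_localDenominator`). With `L(α) = log_p ψ(α / α^c)`
(`conjLog`), every local term then equals `(hp)⁻¹ L(α_w)`, except that the terms at `π` and `π^c`
also contribute `p⁻¹ log_p ψ(σ_π(P))` and `-p⁻¹ log_p ψ(σ_π(P^c))`
(`localComponent_anticycChar_self`, `localComponent_anticycChar_conj`, `conjCompletion_sigmaAt`).

The product of the `α_w` is a unit times `d⁻¹` (`valuation_of_isGlobalDenominator`), and `L`
vanishes on units: these are roots of unity, because `K` is imaginary quadratic
(`conjLog_eq_zero`). Hence `∑ L(α_w) = -L(d) = log_p ψ(d^c / d)` (`finsum_conjLog_eq`). The same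
vanishing makes `ρ` independent of the choice of `α` in its definition (`anticycChar_eq`).

All this needs `log_p` to be a homomorphism (`padicLog_mul`), which follows from the formula
`log u = lim (u ^ (p ^ n) - 1) / p ^ n` on `1 + pℤ_p` (`tendsto_logSeries`).
-/

noncomputable section

namespace AnticycHeight

/-! ### The `p`-adic logarithm is a homomorphism -/

section Logarithm

open Filter Topology

variable {p : ℕ} [Fact p.Prime]

theorem norm_inv_natCast_le (n : ℕ) (hn : n ≠ 0) : ‖((n : ℚ_[p]))⁻¹‖ ≤ n := by
  have hn' : (n : ℚ_[p]) ≠ 0 := Nat.cast_ne_zero.2 hn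
  rw [norm_inv, Padic.norm_eq_zpow_neg_valuation hn', Padic.valuation_natCast, zpow_neg, inv_inv,
    zpow_natCast]
  exact_mod_cast Nat.le_of_dvd (Nat.pos_of_ne_zero hn) pow_padicValNat_dvd

theorem tendsto_prime_pow : Tendsto (fun n : ℕ => ((p : ℚ_[p]) ^ n)) atTop (𝓝 0) :=
  tendsto_pow_atTop_nhds_zero_of_norm_lt_one Padic.norm_p_lt_one

/-- `C(p ^ n - 1, k) → (-1) ^ k` in `ℚ_p` as `n → ∞`, because
`C(p ^ n - 1, k) + C(p ^ n - 1, k + 1) = C(p ^ n, k + 1) → 0`. -/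
theorem tendsto_choose_prime_pow_sub_one (k : ℕ) :
    Tendsto (fun n : ℕ => (((p ^ n - 1).choose k : ℕ) : ℚ_[p])) atTop (𝓝 ((-1) ^ k)) := by
  induction k with
  | zero => simp
  | succ k ih =>
    have hN : ∀ n : ℕ, p ^ n - 1 + 1 = p ^ n := fun n =>
      Nat.sub_add_cancel (Nat.one_le_pow _ _ (Fact.out : p.Prime).pos)
    have hk : ((k : ℚ_[p]) + 1) ≠ 0 := Nat.cast_add_one_ne_zero k
    have h1 : ∀ n : ℕ, (((p ^ n - 1).choose (k + 1) : ℕ) : ℚ_[p]) =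
        (p : ℚ_[p]) ^ n * (((p ^ n - 1).choose k : ℕ) : ℚ_[p]) / ((k : ℚ_[p]) + 1) -
          (((p ^ n - 1).choose k : ℕ) : ℚ_[p]) := by
      intro n
      have e1 := Nat.add_one_mul_choose_eq (p ^ n - 1) k
      have e2 := Nat.choose_succ_succ (p ^ n - 1) k
      rw [Nat.succ_eq_add_one, Nat.succ_eq_add_one] at e2
      rw [e2, hN] at e1
      have e3 : ((p : ℚ_[p]) ^ n * (((p ^ n - 1).choose k : ℕ) : ℚ_[p])) =
          ((((p ^ n - 1).choose k : ℕ) : ℚ_[p]) + (((p ^ n - 1).choose (k + 1) : ℕ) : ℚ_[p])) *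
            ((k : ℚ_[p]) + 1) := by exact_mod_cast e1
      rw [e3, mul_div_cancel_right₀ _ hk]
      ring
    have h2 := ((tendsto_prime_pow (p := p).mul ih).div_const ((k : ℚ_[p]) + 1)).sub ih
    simp only [h1]
    convert h2 using 2
    ring

/-- The logarithm on `1 + pℤ_p` is `lim (u ^ (p ^ n) - 1) / p ^ n`: by the binomial theorem the
`n`-th term is `∑ C(p ^ n - 1, k) (u - 1) ^ (k + 1) / (k + 1)`, and the convergence is dominated. -/
theorem tendsto_logSeries {u : ℚ_[p]} (hu : ‖u - 1‖ < 1) :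
    Tendsto (fun n : ℕ => (u ^ (p ^ n) - 1) / (p : ℚ_[p]) ^ n) atTop (𝓝 (logSeries p u)) := by
  set z := u - 1 with hz
  have hp0 : (p : ℚ_[p]) ≠ 0 := Nat.cast_ne_zero.2 (Fact.out : p.Prime).ne_zero
  have hsum : Summable fun k : ℕ => ((k + 1 : ℕ) : ℝ) * ‖z‖ ^ (k + 1) := by
    have := summable_pow_mul_geometric_of_norm_lt_one (R := ℝ) 1 (r := ‖z‖) (by simpa using hu)
    simpa using (summable_nat_add_iff 1).2 this
  have key : ∀ n : ℕ, (u ^ (p ^ n) - 1) / (p : ℚ_[p]) ^ n =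
      ∑' k : ℕ, (((p ^ n - 1).choose k : ℕ) : ℚ_[p]) * z ^ (k + 1) / ((k : ℚ_[p]) + 1) := by
    intro n
    have hN : p ^ n - 1 + 1 = p ^ n := Nat.sub_add_cancel
      (Nat.one_le_pow _ _ (Fact.out : p.Prime).pos)
    generalize hM : p ^ n - 1 = M at hN ⊢
    have hNQ : (p : ℚ_[p]) ^ n = ((M + 1 : ℕ) : ℚ_[p]) := by rw [hN]; push_cast; rfl
    rw [tsum_eq_sum (s := Finset.range (M + 1))]
    · have hu' : u = z + 1 := by rw [hz]; ring
      rw [hu', add_pow, ← hN, Finset.sum_range_succ', hNQ]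
      simp only [one_pow, mul_one, pow_zero, Nat.choose_zero_right, Nat.cast_one, add_sub_cancel_right]
      rw [Finset.sum_div]
      refine Finset.sum_congr rfl fun k _ => ?_
      have hk : ((k : ℚ_[p]) + 1) ≠ 0 := Nat.cast_add_one_ne_zero k
      have hM1 : ((M + 1 : ℕ) : ℚ_[p]) ≠ 0 := Nat.cast_ne_zero.2 (Nat.succ_ne_zero M)
      have e1 : ((M + 1 : ℕ) : ℚ_[p]) * (M.choose k : ℚ_[p]) =
          ((M + 1).choose (k + 1) : ℚ_[p]) * ((k : ℚ_[p]) + 1) := by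
        exact_mod_cast Nat.add_one_mul_choose_eq M k
      rw [div_eq_div_iff hM1 hk]
      linear_combination -z ^ (k + 1) * e1
    · intro k hk
      rw [Nat.choose_eq_zero_of_lt (by simpa using hk)]
      simp
  simp only [key, logSeries, ← hz]
  refine tendsto_tsum_of_dominated_convergence hsum (fun k => ?_) (Eventually.of_forall fun n k => ?_)
  · exact ((tendsto_choose_prime_pow_sub_one k).mul_const _).div_const _
  · rw [div_eq_mul_inv, norm_mul, norm_mul, norm_pow]
    have h1 : ‖(((p ^ n - 1).choose k : ℕ) : ℚ_[p])‖ ≤ 1 := by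
      simpa using Padic.norm_int_le_one (p := p) ((p ^ n - 1).choose k : ℤ)
    have h2 := norm_inv_natCast_le (p := p) (k + 1) k.succ_ne_zero
    rw [Nat.cast_add_one] at h2
    calc _ ≤ 1 * ‖z‖ ^ (k + 1) * ((k + 1 : ℕ) : ℝ) := by
            push_cast at h2 ⊢
            gcongr
      _ = _ := by ring

theorem logSeries_mul {u v : ℚ_[p]} (hu : ‖u - 1‖ < 1) (hv : ‖v - 1‖ < 1) :
    logSeries p (u * v) = logSeries p u + logSeries p v := by
  have huv : ‖u * v - 1‖ < 1 := by
    have : u * v - 1 = (u - 1) * (v - 1) + ((u - 1) + (v - 1)) := by ring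
    rw [this]
    refine (IsUltrametricDist.norm_add_le_max _ _).trans_lt (max_lt ?_
      ((IsUltrametricDist.norm_add_le_max _ _).trans_lt (max_lt hu hv)))
    rw [norm_mul]
    exact mul_lt_one_of_nonneg_of_lt_one_left (norm_nonneg _) hu hv.le
  have hp0 : (p : ℚ_[p]) ≠ 0 := Nat.cast_ne_zero.2 (Fact.out : p.Prime).ne_zero
  have h1 := tendsto_logSeries hu
  have h2 := tendsto_logSeries hv
  have h3 := ((tendsto_prime_pow (p := p)).mul (h1.mul h2)).add (h1.add h2)
  rw [zero_mul, zero_add] at h3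
  refine tendsto_nhds_unique (tendsto_logSeries huv) (h3.congr fun n => ?_)
  field_simp
  ring

/-- Fermat's little theorem in the residue field: `x ^ (p - 1) ∈ 1 + pℤ_p` for a unit `x`. -/
theorem norm_pow_sub_one_lt {x : ℚ_[p]} (hx : ‖x‖ = 1) : ‖x ^ (p - 1) - 1‖ < 1 := by
  let y : ℤ_[p] := ⟨x, hx.le⟩
  have hy : PadicInt.toZMod y ≠ 0 := by
    intro h
    have : y ∈ RingHom.ker (PadicInt.toZMod : ℤ_[p] →+* ZMod p) := h
    rw [PadicInt.ker_toZMod, IsLocalRing.mem_maximalIdeal, mem_nonunits_iff,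
      PadicInt.isUnit_iff] at this
    exact this hx
  have h1 : y ^ (p - 1) - 1 ∈ RingHom.ker (PadicInt.toZMod : ℤ_[p] →+* ZMod p) := by
    rw [RingHom.mem_ker, map_sub, map_pow, ZMod.pow_card_sub_one_eq_one hy, map_one, sub_self]
  rw [PadicInt.ker_toZMod, IsLocalRing.mem_maximalIdeal, PadicInt.mem_nonunits] at h1
  rw [PadicInt.norm_def] at h1
  push_cast at h1
  exact h1

theorem norm_mul_zpow_neg_valuation {x : ℚ_[p]} (hx : x ≠ 0) :
    ‖x * (p : ℚ_[p]) ^ (-x.valuation)‖ = 1 := by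
  have hp : (p : ℝ) ≠ 0 := Nat.cast_ne_zero.2 (Fact.out : p.Prime).ne_zero
  rw [norm_mul, Padic.norm_eq_zpow_neg_valuation hx, norm_zpow, Padic.norm_p, inv_zpow', neg_neg,
    ← zpow_add₀ hp, neg_add_cancel, zpow_zero]

theorem padicLog_mul {x y : ℚ_[p]} (hx : x ≠ 0) (hy : y ≠ 0) :
    padicLog p (x * y) = padicLog p x + padicLog p y := by
  have hp : (p : ℚ_[p]) ≠ 0 := Nat.cast_ne_zero.2 (Fact.out : p.Prime).ne_zero
  unfold padicLog
  rw [← mul_add, ← logSeries_mul (norm_pow_sub_one_lt (norm_mul_zpow_neg_valuation hx))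
    (norm_pow_sub_one_lt (norm_mul_zpow_neg_valuation hy)), ← mul_pow, Padic.valuation_mul hx hy,
    neg_add, zpow_add₀ hp]
  congr 3
  ring

theorem padicLog_one : padicLog p 1 = 0 := by
  simpa using padicLog_mul (p := p) one_ne_zero one_ne_zero

theorem padicLog_inv {x : ℚ_[p]} (hx : x ≠ 0) : padicLog p x⁻¹ = -padicLog p x := by
  rw [eq_neg_iff_add_eq_zero, ← padicLog_mul (inv_ne_zero hx) hx, inv_mul_cancel₀ hx, padicLog_one]

theorem padicLog_pow {x : ℚ_[p]} (hx : x ≠ 0) (n : ℕ) :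
    padicLog p (x ^ n) = n * padicLog p x := by
  induction n with
  | zero => simp [padicLog_one]
  | succ n ih =>
    rw [pow_succ, padicLog_mul (pow_ne_zero n hx) hx, ih]
    push_cast
    ring

theorem padicLog_div {x y : ℚ_[p]} (hx : x ≠ 0) (hy : y ≠ 0) :
    padicLog p (x / y) = padicLog p x - padicLog p y := by
  rw [div_eq_mul_inv, padicLog_mul hx (inv_ne_zero hy), padicLog_inv hy, sub_eq_add_neg]

end Logarithm

/-! ### The anticyclotomic character in terms of a generator -/

section Character

variable {K : Type*} [Field K] [NumberField K] {p : ℕ} [Fact p.Prime]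

theorem coe_eq_algebraMap (v : HeightOneSpectrum (𝓞 K)) (x : K) :
    (x : v.adicCompletion K) = algebraMap K (v.adicCompletion K) x := rfl

open scoped WithZeroTopology in
/-- The extension of `c` to the completions is an isometry, by density of `K`. -/
theorem valued_conjCompletion (c : K ≃ₐ[ℚ] K) (v : HeightOneSpectrum (𝓞 K))
    (z : (conjPrime c v).adicCompletion K) :
    Valued.v (conjCompletion c v z) = Valued.v z := by
  have hc : Continuous (conjCompletion c v) :=
    (HeightOneSpectrum.adicCompletion.continuous_ofCompletion K v).comp
      (UniformSpace.Completion.continuous_map.comp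
        (HeightOneSpectrum.adicCompletion.continuous_toCompletion K (conjPrime c v)))
  have hv := Valued.continuous_valuation_of_surjective (v.valuedAdicCompletion_surjective K)
  have hv' := Valued.continuous_valuation_of_surjective
    ((conjPrime c v).valuedAdicCompletion_surjective K)
  refine congrFun (DenseRange.equalizer ((conjPrime c v).denseRange_algebraMap K)
    (hv.comp hc) hv' (funext fun x => ?_)) z
  have := conjCompletion_coe c v x
  rw [coe_eq_algebraMap] at this
  simp only [Function.comp_apply, this, HeightOneSpectrum.adicCompletion.valued_coe,
    valuation_conjPrime]
  exact (HeightOneSpectrum.adicCompletion.valued_coe K (conjPrime c v) x).symm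

theorem isOfFinOrder_of_isTotallyComplex (hK2 : Module.finrank ℚ K = 2) (hK : IsTotallyComplex K)
    (u : (𝓞 K)ˣ) : IsOfFinOrder u := by
  -- `K` has a single infinite place, so its unit rank is `0`.
  have hr : Units.rank K = 0 := by
    have h1 := IsTotallyComplex.finrank K
    rw [hK2] at h1
    have h2 := InfinitePlace.card_eq_nrRealPlaces_add_nrComplexPlaces K
    rw [IsTotallyComplex.nrRealPlaces_eq_zero] at h2
    rw [Units.rank]
    omega
  obtain ⟨⟨ζ, f⟩, hf, -⟩ := Units.exist_unique_eq_mul_prod K u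
  have : IsEmpty (Fin (Units.rank K)) := by rw [hr]; infer_instance
  rw [Finset.univ_eq_empty, Finset.prod_empty, mul_one] at hf
  rw [hf]
  exact ζ.2

variable (c : K ≃ₐ[ℚ] K) {π : HeightOneSpectrum (𝓞 K)} (ψ : π.adicCompletion K ≃+* ℚ_[p])

/-- The homomorphism `α ↦ log_p ψ(α / α^c)` on `K^×`. (Its value at `0` is irrelevant.) -/
def conjLog (α : K) : ℚ_[p] := padicLog p (ψ ((α / c α : K) : π.adicCompletion K))

theorem conjLog_arg_ne_zero {α : K} (hα : α ≠ 0) :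
    ψ ((α / c α : K) : π.adicCompletion K) ≠ 0 := by
  rw [coe_eq_algebraMap]
  simpa using hα

theorem conjLog_mul {α β : K} (hα : α ≠ 0) (hβ : β ≠ 0) :
    conjLog c ψ (α * β) = conjLog c ψ α + conjLog c ψ β := by
  unfold conjLog
  rw [← padicLog_mul (conjLog_arg_ne_zero c ψ hα) (conjLog_arg_ne_zero c ψ hβ)]
  simp only [coe_eq_algebraMap, ← map_mul, div_mul_div_comm]

theorem conjLog_one : conjLog c ψ 1 = 0 := by
  simpa using conjLog_mul c ψ one_ne_zero one_ne_zero

theorem conjLog_pow {α : K} (hα : α ≠ 0) (n : ℕ) :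
    conjLog c ψ (α ^ n) = n * conjLog c ψ α := by
  induction n with
  | zero => simp [conjLog_one]
  | succ n ih =>
    rw [pow_succ, conjLog_mul c ψ (pow_ne_zero n hα) hα, ih]
    push_cast
    ring

theorem conjLog_prod {ι : Type*} (s : Finset ι) (f : ι → K) (hf : ∀ i ∈ s, f i ≠ 0) :
    conjLog c ψ (∏ i ∈ s, f i) = ∑ i ∈ s, conjLog c ψ (f i) := by
  classical
  induction s using Finset.induction_on with
  | empty => simp [conjLog_one]
  | insert i s hi ih =>
    rw [Finset.prod_insert hi, Finset.sum_insert hi, conjLog_mul, ih]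
    · exact fun j hj => hf j (Finset.mem_insert_of_mem hj)
    · exact hf i (Finset.mem_insert_self i s)
    · exact Finset.prod_ne_zero_iff.2 fun j hj => hf j (Finset.mem_insert_of_mem hj)

/-- `log_p ψ(α / α^c)` vanishes if `α` has trivial valuation everywhere: `α` is then a unit of
`𝒪_K`, hence a root of unity, as `K` is imaginary quadratic. -/
theorem conjLog_eq_zero (hK2 : Module.finrank ℚ K = 2) (hK : IsTotallyComplex K) {α : K}
    (hα : ∀ v : HeightOneSpectrum (𝓞 K), v.valuation K α = 1) : conjLog c ψ α = 0 := by
  have hα0 : α ≠ 0 := by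
    rintro rfl
    simpa using hα π
  obtain ⟨a, ha⟩ := HeightOneSpectrum.mem_integers_of_valuation_le_one K α fun v => (hα v).le
  obtain ⟨b, hb⟩ := HeightOneSpectrum.mem_integers_of_valuation_le_one K α⁻¹ fun v => by
    rw [map_inv₀, hα v, inv_one]
  have hab : a * b = 1 := by
    apply FaithfulSMul.algebraMap_injective (𝓞 K) K
    rw [map_mul, ha, hb, mul_inv_cancel₀ hα0, map_one]
  obtain ⟨n, hn, hu⟩ := isOfFinOrder_iff_pow_eq_one.1
    (isOfFinOrder_of_isTotallyComplex hK2 hK (Units.mkOfMulEqOne a b hab))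
  have hαn : α ^ n = 1 := by
    have := congrArg (fun u : (𝓞 K)ˣ => algebraMap (𝓞 K) K u) hu
    simpa [ha] using this
  have h := conjLog_pow c ψ hα0 n
  rw [hαn, conjLog_one] at h
  exact (mul_eq_zero.1 h.symm).resolve_left (Nat.cast_ne_zero.2 hn.ne')

theorem conjLog_congr (hK2 : Module.finrank ℚ K = 2) (hK : IsTotallyComplex K) {α β : K}
    (hβ : β ≠ 0) (h : ∀ v : HeightOneSpectrum (𝓞 K), v.valuation K α = v.valuation K β) :
    conjLog c ψ α = conjLog c ψ β := by
  have h1 : ∀ v : HeightOneSpectrum (𝓞 K), v.valuation K (α / β) = 1 := fun v => by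
    rw [map_div₀, h v, div_self ((Valuation.ne_zero_iff _).2 hβ)]
  have hα : α / β ≠ 0 := by
    intro h0
    simpa [h0] using h1 π
  rw [← div_mul_cancel₀ α hβ, conjLog_mul c ψ hα hβ, conjLog_eq_zero c ψ hK2 hK h1, zero_add]

/-- `ρ(x)` may be computed with any `α` such that `α x_v ^ h` is a unit everywhere. -/
theorem anticycChar_eq (hK2 : Module.finrank ℚ K = 2) (hK : IsTotallyComplex K)
    (x : (AdeleRing (𝓞 K) K)ˣ) (α : Kˣ) (hα : Trivializes x α) :
    anticycChar p c π ψ x = 1 / ((classNumber K : ℚ_[p]) * p) * (conjLog c ψ α +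
      padicLog p (ψ (((x : AdeleRing (𝓞 K) K).2 π) ^ classNumber K /
        (conjCompletion c π ((x : AdeleRing (𝓞 K) K).2 (conjPrime c π))) ^ classNumber K))) := by
  -- All `x_v` are nonzero, so no quotient below takes a junk value.
  have hx : ∀ v, (x : AdeleRing (𝓞 K) K).2 v ^ classNumber K ≠ 0 := fun v h0 => by
    have := hα v
    rw [h0] at this
    simp at this
  have hex : ∃ α : Kˣ, Trivializes x α := ⟨α, hα⟩
  rw [anticycChar, dif_pos hex]
  have hβ := hex.choose_spec
  set β := hex.choose
  have hαβ : conjLog c ψ α = conjLog c ψ β := by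
    refine conjLog_congr c ψ hK2 hK β.ne_zero fun v => ?_
    have h1 := hα v
    rw [← hβ v, map_mul, map_mul] at h1
    have h2 := mul_right_cancel₀ ((Valuation.ne_zero_iff _).2 (hx v)) h1
    simpa using h2
  rw [hαβ, conjLog, ← padicLog_mul (conjLog_arg_ne_zero c ψ β.ne_zero), ← map_mul]
  · congr 3
    rw [coe_eq_algebraMap _ ((β : K) / c β), map_div₀, div_mul_div_comm]
    rfl
  · rw [Ne, map_eq_zero_iff _ ψ.injective, div_eq_zero_iff, not_or]
    refine ⟨hx π, ?_⟩
    rw [← map_pow, map_eq_zero_iff _ (conjCompletion c π).injective]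
    exact hx _

theorem placeInclusion_apply_self (w : HeightOneSpectrum (𝓞 K)) (y : w.adicCompletion K) :
    (placeInclusion w y).2 w = y := by
  classical
  exact Pi.mulSingle_eq_same w y

theorem placeInclusion_apply_of_ne {v w : HeightOneSpectrum (𝓞 K)} (h : v ≠ w)
    (y : w.adicCompletion K) : (placeInclusion w y).2 v = 1 := by
  classical
  exact Pi.mulSingle_eq_of_ne h y

/-- `α` generates the fractional ideal `w ^ (-h ord_w(y))`. -/
def TrivializesAt (w : HeightOneSpectrum (𝓞 K)) (y : w.adicCompletion K) (α : K) : Prop :=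
  w.valuation K α * Valued.v y ^ classNumber K = 1 ∧ ∀ v, v ≠ w → v.valuation K α = 1

theorem TrivializesAt.ne_zero {w : HeightOneSpectrum (𝓞 K)} {y : w.adicCompletion K} {α : K}
    (h : TrivializesAt w y α) : α ≠ 0 := by
  rintro rfl
  simpa using h.1

theorem TrivializesAt.arg_ne_zero {w : HeightOneSpectrum (𝓞 K)} {y : w.adicCompletion K} {α : K}
    (h : TrivializesAt w y α) : y ≠ 0 := by
  rintro rfl
  simpa [classNumber_ne_zero] using h.1

theorem TrivializesAt.trivializes {w : HeightOneSpectrum (𝓞 K)} {y : w.adicCompletion K} {α : K}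
    (h : TrivializesAt w y α) (hy : y ≠ 0) :
    Trivializes (Units.map (placeInclusion w) (Units.mk0 y hy)) (Units.mk0 α h.ne_zero) := by
  intro v
  rw [Units.coe_map, Units.val_mk0, Units.val_mk0, map_mul, map_pow]
  rcases eq_or_ne v w with rfl | hv
  · rw [placeInclusion_apply_self]
    simpa using h.1
  · rw [placeInclusion_apply_of_ne hv]
    simpa using h.2 v hv

/-- The `h`-th power of a prime ideal is principal. -/
theorem exists_valuation_eq_exp_classNumber (w : HeightOneSpectrum (𝓞 K)) :
    ∃ β : K, w.valuation K β = WithZero.exp (-(classNumber K : ℤ)) ∧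
      ∀ v, v ≠ w → v.valuation K β = 1 := by
  have hw : w.asIdeal ∈ nonZeroDivisors (Ideal (𝓞 K)) := mem_nonZeroDivisors_of_ne_zero w.ne_bot
  have h1 : ClassGroup.mk0 (⟨w.asIdeal, hw⟩ ^ classNumber K) = 1 := by
    rw [map_pow, classNumber, pow_card_eq_one]
  rw [ClassGroup.mk0_eq_one_iff] at h1
  obtain ⟨b, hb⟩ := h1.principal
  have hb' : w.asIdeal ^ classNumber K = Ideal.span {b} := hb
  have hmem : ∀ I : Ideal (𝓞 K), b ∈ I ↔ w.asIdeal ^ classNumber K ≤ I := fun I => by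
    rw [hb', Ideal.span_singleton_le_iff_mem]
  refine ⟨b, ?_, fun v hv => ?_⟩
  · have hb0 : b ≠ 0 := by
      rintro rfl
      rw [Ideal.span_singleton_zero] at hb'
      exact pow_ne_zero _ w.ne_bot hb'
    rw [HeightOneSpectrum.valuation_of_algebraMap]
    refine le_antisymm ((w.intValuation_le_pow_iff_mem b _).2 ((hmem _).2 le_rfl)) ?_
    by_contra! hlt
    have h2 : w.intValuation b ≤ WithZero.exp (-((classNumber K + 1 : ℕ) : ℤ)) := by
      rw [HeightOneSpectrum.intValuation_if_neg _ hb0, WithZero.exp_lt_exp] at hlt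
      rw [HeightOneSpectrum.intValuation_if_neg _ hb0, WithZero.exp_le_exp]
      push_cast
      omega
    rw [HeightOneSpectrum.intValuation_le_pow_iff_mem, hmem] at h2
    exact absurd h2 (Ideal.pow_succ_lt_pow w.ne_bot (classNumber K)).not_ge
  · rw [HeightOneSpectrum.valuation_of_algebraMap, HeightOneSpectrum.intValuation_eq_one_iff, hmem]
    intro hle
    have h3 : w.asIdeal ≤ v.asIdeal := v.isPrime.le_of_pow_le hle
    exact hv (HeightOneSpectrum.ext (w.isMaximal.eq_of_le v.isPrime.ne_top h3).symm)

/-- For every `y ∈ K_w^×` some power of a generator of `w ^ h` trivialises `y` at `w`. -/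
theorem exists_trivializesAt {w : HeightOneSpectrum (𝓞 K)} {y : w.adicCompletion K} (hy : y ≠ 0) :
    ∃ α : K, TrivializesAt w y α := by
  obtain ⟨β, hβ, hβ'⟩ := exists_valuation_eq_exp_classNumber w
  obtain ⟨n, hn⟩ : ∃ n : ℤ, Valued.v y = WithZero.exp n :=
    ⟨_, (WithZero.exp_log ((Valuation.ne_zero_iff _).2 hy)).symm⟩
  refine ⟨β ^ n, ?_, fun v hv => by rw [map_zpow₀, hβ' v hv, one_zpow]⟩
  rw [map_zpow₀, hβ, hn, ← WithZero.exp_zsmul, ← WithZero.exp_nsmul, ← WithZero.exp_add,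
    ← WithZero.exp_zero]
  congr 1
  simp only [smul_eq_mul, nsmul_eq_mul]
  ring

theorem localComponent_anticycChar_of_ne (hK2 : Module.finrank ℚ K = 2) (hK : IsTotallyComplex K)
    {w : HeightOneSpectrum (𝓞 K)} {y : w.adicCompletion K} {α : K} (h : TrivializesAt w y α)
    (hw : w ≠ π) (hw' : w ≠ conjPrime c π) :
    localComponent (anticycChar p c π ψ) w y =
      1 / ((classNumber K : ℚ_[p]) * p) * conjLog c ψ α := by
  rw [localComponent, dif_pos h.arg_ne_zero,
    anticycChar_eq c ψ hK2 hK _ _ (h.trivializes h.arg_ne_zero), Units.coe_map, Units.val_mk0,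
    placeInclusion_apply_of_ne hw.symm, placeInclusion_apply_of_ne hw'.symm]
  simp [padicLog_one]

theorem localComponent_anticycChar_self (hK2 : Module.finrank ℚ K = 2) (hK : IsTotallyComplex K)
    {y : π.adicCompletion K} {α : K} (h : TrivializesAt π y α) (hπ : conjPrime c π ≠ π) :
    localComponent (anticycChar p c π ψ) π y = 1 / ((classNumber K : ℚ_[p]) * p) *
      (conjLog c ψ α + classNumber K * padicLog p (ψ y)) := by
  rw [localComponent, dif_pos h.arg_ne_zero,
    anticycChar_eq c ψ hK2 hK _ _ (h.trivializes h.arg_ne_zero), Units.coe_map, Units.val_mk0,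
    placeInclusion_apply_self, placeInclusion_apply_of_ne hπ, map_one, one_pow,
    div_one, map_pow, padicLog_pow, Units.val_mk0]
  exact (map_ne_zero_iff _ ψ.injective).2 h.arg_ne_zero

theorem localComponent_anticycChar_conj (hK2 : Module.finrank ℚ K = 2) (hK : IsTotallyComplex K)
    {y : (conjPrime c π).adicCompletion K} {α : K} (h : TrivializesAt (conjPrime c π) y α)
    (hπ : conjPrime c π ≠ π) :
    localComponent (anticycChar p c π ψ) (conjPrime c π) y = 1 / ((classNumber K : ℚ_[p]) * p) *
      (conjLog c ψ α - classNumber K * padicLog p (ψ (conjCompletion c π y))) := by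
  have hy : ψ (conjCompletion c π y) ≠ 0 := (map_ne_zero_iff _ ψ.injective).2
    ((map_ne_zero_iff _ (conjCompletion c π).injective).2 h.arg_ne_zero)
  rw [localComponent, dif_pos h.arg_ne_zero,
    anticycChar_eq c ψ hK2 hK _ _ (h.trivializes h.arg_ne_zero), Units.coe_map, Units.val_mk0,
    placeInclusion_apply_self, placeInclusion_apply_of_ne hπ.symm, one_pow,
    map_div₀ ψ, map_one ψ, map_pow, Units.val_mk0, padicLog_div one_ne_zero (pow_ne_zero _ hy),
    padicLog_one, padicLog_pow hy, zero_sub, sub_eq_add_neg]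

end Character

/-! ### The absolute value of the sigma function -/

section SigmaValue

variable (W : WeierstrassCurve ℤ) (p : ℕ) [Fact p.Prime]

/-- The leading term of `σ_p` is `t`, whichever branch of the definition of `padicSigma` applies. -/
theorem constantCoeff_padicSigma : PowerSeries.constantCoeff (padicSigma W p) = 0 := by
  rw [padicSigma]
  split_ifs with h
  · exact h.choose_spec.1
  · simp

theorem coeff_one_padicSigma : PowerSeries.coeff 1 (padicSigma W p) = 1 := by
  rw [padicSigma]
  split_ifs with h
  · exact h.choose_spec.2.1
  · simp

/-- Since `σ_p(t) = t + ⋯` has coefficients in `ℤ_p`, `σ_p(t)` and `t` have the same absolute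
value for `t ∈ pℤ_p`. -/
theorem norm_sigmaEval {t : ℚ_[p]} (ht : ‖t‖ < 1) : ‖sigmaEval W p t‖ = ‖t‖ := by
  rcases eq_or_ne t 0 with rfl | ht0
  · have h0 : sigmaEval W p 0 = 0 := by
      rw [sigmaEval]
      refine (tsum_congr fun n => ?_).trans tsum_zero
      rcases n with _ | n
      · simp [constantCoeff_padicSigma]
      · simp
    rw [h0]
  set f : ℕ → ℚ_[p] := fun n => ((PowerSeries.coeff n (padicSigma W p) : ℤ_[p]) : ℚ_[p]) * t ^ n
  have hf : ∀ n, ‖f n‖ ≤ ‖t‖ ^ n := fun n => by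
    rw [norm_mul, norm_pow]
    exact mul_le_of_le_one_left (by positivity) (PadicInt.norm_le_one _)
  have hs : Summable f := Summable.of_norm_bounded (summable_geometric_of_lt_one (norm_nonneg t) ht) hf
  have hsplit : sigmaEval W p t = t + ∑' n, f (n + 2) := by
    have := hs.sum_add_tsum_nat_add 2
    rw [sigmaEval, ← this, Finset.sum_range_succ, Finset.sum_range_one]
    simp [f, constantCoeff_padicSigma, coeff_one_padicSigma]
  -- The remaining terms are divisible by `t ^ 2`.
  have htail : ‖∑' n, f (n + 2)‖ ≤ ‖t‖ ^ 2 := by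
    refine IsUltrametricDist.norm_tsum_le_of_forall_le_of_nonneg (by positivity) fun n => ?_
    exact (hf _).trans (pow_le_pow_of_le_one (norm_nonneg t) ht.le (by omega))
  have hlt : ‖∑' n, f (n + 2)‖ < ‖t‖ := htail.trans_lt (by
    have := norm_pos_iff.2 ht0
    nlinarith)
  rw [hsplit, IsUltrametricDist.norm_add_eq_max_of_norm_ne_norm hlt.ne', max_eq_left hlt.le]

end SigmaValue

/-! ### Valuations of the coordinates of a point -/

section Valuations

variable {K : Type*} [Field K] {W : WeierstrassCurve ℤ}

theorem coord_equation {P : (W⁄K).toAffine.Point} (hP : P ≠ 0) :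
    yCoord P ^ 2 + W.a₁ * xCoord P * yCoord P + W.a₃ * yCoord P =
      xCoord P ^ 3 + W.a₂ * xCoord P ^ 2 + W.a₄ * xCoord P + W.a₆ := by
  cases P with
  | zero => exact absurd rfl hP
  | some x y h =>
    have := (Affine.equation_iff ..).1 h.1
    simpa [xCoord, yCoord] using this

variable {Γ : Type*} [LinearOrderedCommGroupWithZero Γ] (v : Valuation K Γ)

theorem valuation_intCast_le_one (n : ℤ) : v (n : K) ≤ 1 := by
  have h : (n : K) ∈ v.integer := intCast_mem _ n
  exact h

/-- At a point reducing to the origin, the pole orders of `x` and `y` are in the ratio `2 : 3`. -/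
theorem valuation_yCoord_sq {P : (W⁄K).toAffine.Point} (hP : P ≠ 0) (hx : 1 < v (xCoord P)) :
    v (yCoord P) ^ 2 = v (xCoord P) ^ 3 := by
  have h := coord_equation hP
  set x := xCoord P
  set y := yCoord P
  have hx0 : 0 < v x := zero_lt_one.trans hx
  have hc := valuation_intCast_le_one v
  have h12 : v x ≤ v x ^ 2 := le_self_pow₀ hx.le two_ne_zero
  have h23 : v x ^ 2 < v x ^ 3 := pow_lt_pow_right₀ hx (by norm_num)
  have hr : v (W.a₂ * x ^ 2 + W.a₄ * x + W.a₆) ≤ v x ^ 2 := by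
    refine v.map_add_le (v.map_add_le ?_ ?_) ?_
    · rw [map_mul, map_pow]
      exact mul_le_of_le_one_left' (hc _)
    · rw [map_mul]
      exact (mul_le_of_le_one_left' (hc _)).trans h12
    · exact (hc _).trans (hx.le.trans h12)
  -- On the right-hand side of the equation `x ^ 3` dominates.
  have hR : v (x ^ 3 + W.a₂ * x ^ 2 + W.a₄ * x + W.a₆) = v x ^ 3 := by
    have e : x ^ 3 + W.a₂ * x ^ 2 + W.a₄ * x + W.a₆ =
      x ^ 3 + (W.a₂ * x ^ 2 + W.a₄ * x + W.a₆) := by ring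
    rw [e, Valuation.map_add_eq_of_lt_left, map_pow]
    rw [map_pow]
    exact hr.trans_lt h23
  have hl : v (W.a₁ * x + W.a₃) ≤ v x := by
    refine v.map_add_le ?_ ((hc _).trans hx.le)
    rw [map_mul]
    exact mul_le_of_le_one_left' (hc _)
  have e : y ^ 2 + W.a₁ * x * y + W.a₃ * y = y * (y + (W.a₁ * x + W.a₃)) := by ring
  rw [e] at h
  have hL := congrArg v h
  rw [hR, map_mul] at hL
  -- If `y` did not dominate `x`, the left-hand side would be at most `v x ^ 2`.
  have hxy : v x < v y := by
    by_contra! hle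
    have h1 : v y * v (y + (W.a₁ * x + W.a₃)) ≤ v x * v x :=
      mul_le_mul' hle (v.map_add_le hle hl)
    rw [hL, ← sq] at h1
    exact h1.not_gt h23
  rw [Valuation.map_add_eq_of_lt_left v (hl.trans_lt hxy), ← sq] at hL
  exact hL

theorem valuation_yCoord_le_one {P : (W⁄K).toAffine.Point} (hP : P ≠ 0) (hx : v (xCoord P) ≤ 1) :
    v (yCoord P) ≤ 1 := by
  have h := coord_equation hP
  set x := xCoord P
  set y := yCoord P
  have hc := valuation_intCast_le_one v
  have hR : v (x ^ 3 + W.a₂ * x ^ 2 + W.a₄ * x + W.a₆) ≤ 1 := by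
    refine v.map_add_le (v.map_add_le (v.map_add_le ?_ ?_) ?_) (hc _)
    · rw [map_pow]
      exact pow_le_one' hx 3
    · rw [map_mul, map_pow]
      exact mul_le_one' (hc _) (pow_le_one' hx 2)
    · rw [map_mul]
      exact mul_le_one' (hc _) hx
  by_contra! hy
  have hl : v (W.a₁ * x + W.a₃) ≤ 1 := by
    refine v.map_add_le ?_ (hc _)
    rw [map_mul]
    exact mul_le_one' (hc _) hx
  have e : y ^ 2 + W.a₁ * x * y + W.a₃ * y = y * (y + (W.a₁ * x + W.a₃)) := by ring
  rw [← h, e, map_mul, Valuation.map_add_eq_of_lt_left v (hl.trans_lt hy)] at hR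
  exact hR.not_gt (one_lt_mul'' hy hy)

/-- At a point reducing to the origin, `x = t⁻²` up to a unit, where `t = x / y`. -/
theorem valuation_param_sq {P : (W⁄K).toAffine.Point} (hP : P ≠ 0) (hx : 1 < v (xCoord P)) :
    v (xCoord P / yCoord P) ^ 2 = (v (xCoord P))⁻¹ := by
  have hx0 : v (xCoord P) ≠ 0 := (zero_lt_one.trans hx).ne'
  rw [map_div₀, div_pow, valuation_yCoord_sq v hP hx]
  field_simp

theorem valuation_param_lt_one {P : (W⁄K).toAffine.Point} (hP : P ≠ 0) (hx : 1 < v (xCoord P)) :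
    v (xCoord P / yCoord P) < 1 := by
  have h := valuation_param_sq v hP hx
  by_contra! hle
  exact (inv_lt_one_of_one_lt₀ hx).not_ge (h ▸ one_le_pow₀ hle)

theorem param_ne_zero {P : (W⁄K).toAffine.Point} (hP : P ≠ 0) (hx : 1 < v (xCoord P)) :
    xCoord P / yCoord P ≠ 0 := by
  intro h0
  have h := valuation_param_sq v hP hx
  rw [h0, map_zero, zero_pow two_ne_zero] at h
  exact inv_ne_zero (zero_lt_one.trans hx).ne' h.symm

theorem valuation_param_cube {P : (W⁄K).toAffine.Point} (hP : P ≠ 0) (hx : 1 < v (xCoord P)) :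
    v (xCoord P / yCoord P) ^ 3 = (v (yCoord P))⁻¹ := by
  have hx0 : v (xCoord P) ≠ 0 := (zero_lt_one.trans hx).ne'
  have hy0 : v (yCoord P) ≠ 0 := fun h0 => by
    have := valuation_yCoord_sq v hP hx
    rw [h0, zero_pow two_ne_zero] at this
    exact pow_ne_zero 3 hx0 this.symm
  rw [map_div₀, div_pow, ← valuation_yCoord_sq v hP hx]
  field_simp

end Valuations

/-! ### Local denominators -/

section LocalDenominator

variable {K : Type*} [Field K] [NumberField K] {W : WeierstrassCurve ℤ}
  {w : HeightOneSpectrum (𝓞 K)}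

theorem isCoprime_of_valued_eq_one {a d : w.adicCompletionIntegers K}
    (ha : Valued.v (a : w.adicCompletion K) = 1) : IsCoprime a d := by
  have ha0 : (a : w.adicCompletion K) ≠ 0 := by
    intro h0
    simp [h0] at ha
  refine ⟨⟨(a : w.adicCompletion K)⁻¹, ?_⟩, 0, ?_⟩
  · rw [HeightOneSpectrum.mem_adicCompletionIntegers, map_inv₀, ha, inv_one]
  · ext1
    simp [ha0]

theorem valued_eq_one_of_isCoprime {a d : w.adicCompletionIntegers K} (h : IsCoprime a d)
    (hd : Valued.v (d : w.adicCompletion K) < 1) : Valued.v (a : w.adicCompletion K) = 1 := by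
  obtain ⟨r, s, hrs⟩ := h
  have hle : ∀ z : w.adicCompletionIntegers K, Valued.v (z : w.adicCompletion K) ≤ 1 := fun z =>
    (HeightOneSpectrum.mem_adicCompletionIntegers _ _ _).1 z.2
  refine (hle a).antisymm (not_lt.1 fun hlt => ?_)
  have h1 : Valued.v ((r * a + s * d : w.adicCompletionIntegers K) : w.adicCompletion K) < 1 := by
    push_cast
    refine Valuation.map_add_lt _ ?_ ?_
    · rw [map_mul]
      exact mul_lt_one_of_nonneg_of_lt_one_right (hle r) zero_le hlt
    · rw [map_mul]
      exact mul_lt_one_of_nonneg_of_lt_one_right (hle s) zero_le hd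
  rw [hrs] at h1
  simp at h1

/-- The valuation at `w` of a denominator of `P`: that of the parameter `x / y` if `P` reduces to
the origin, and `1` otherwise. -/
def denominatorValuation (w : HeightOneSpectrum (𝓞 K)) (P : (W⁄K).toAffine.Point) :
    WithZero (Multiplicative ℤ) :=
  if 1 < w.valuation K (xCoord P) then w.valuation K (xCoord P / yCoord P) else 1

/-- A local denominator is unique up to a unit. -/
theorem valued_eq_denominatorValuation {P : (W⁄K).toAffine.Point} (hP : P ≠ 0)
    {d : w.adicCompletionIntegers K} (hd : IsLocalDenominator w P d) :
    Valued.v (d : w.adicCompletion K) = denominatorValuation w P := by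
  obtain ⟨hd0, a, b, had, -, hx, -⟩ := hd
  have hle : ∀ z : w.adicCompletionIntegers K, Valued.v (z : w.adicCompletion K) ≤ 1 := fun z =>
    (HeightOneSpectrum.mem_adicCompletionIntegers _ _ _).1 z.2
  have hx' := congrArg Valued.v hx
  rw [HeightOneSpectrum.adicCompletion.valued_coe, map_div₀, map_pow] at hx'
  rw [denominatorValuation]
  rcases (hle d).lt_or_eq with hlt | heq
  · have hd0' : Valued.v (d : w.adicCompletion K) ≠ 0 := by
      rw [Valuation.ne_zero_iff]
      exact_mod_cast hd0
    rw [valued_eq_one_of_isCoprime had hlt, one_div] at hx'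
    have h1 : 1 < w.valuation K (xCoord P) := by
      rw [hx', one_lt_inv₀ (pow_pos (zero_lt_iff.2 hd0') 2)]
      exact pow_lt_one₀ zero_le hlt two_ne_zero
    rw [if_pos h1]
    have h2 := valuation_param_sq (w.valuation K) hP h1
    rw [hx', inv_inv] at h2
    exact ((pow_left_inj₀ zero_le zero_le two_ne_zero).1 h2).symm
  · rw [heq, one_pow, div_one] at hx'
    rw [if_neg (hx' ▸ (hle a).not_gt), heq]

/-- The parameter `x / y` is a local denominator of a point that reduces to the origin, and `1`
is one of any other point. -/
theorem exists_isLocalDenominator {P : (W⁄K).toAffine.Point} (hP : P ≠ 0) :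
    ∃ d : w.adicCompletionIntegers K, IsLocalDenominator w P d := by
  have hv := HeightOneSpectrum.adicCompletion.valued_coe K w
  rcases lt_or_ge 1 (w.valuation K (xCoord P)) with hx | hx
  · have ht := valuation_param_lt_one _ hP hx
    have ht0 := param_ne_zero _ hP hx
    have hx0 : w.valuation K (xCoord P) ≠ 0 := (zero_lt_one.trans hx).ne'
    have h2 := valuation_param_sq _ hP hx
    have h3 := valuation_param_cube _ hP hx
    have hy0 : w.valuation K (yCoord P) ≠ 0 := fun h0 => by
      rw [h0, inv_zero] at h3
      exact pow_ne_zero 3 ((Valuation.ne_zero_iff _).2 ht0) h3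
    set t : K := xCoord P / yCoord P
    have ha : w.valuation K (xCoord P * t ^ 2) = 1 := by
      rw [map_mul, map_pow, h2, mul_inv_cancel₀ hx0]
    have hb : w.valuation K (yCoord P * t ^ 3) = 1 := by
      rw [map_mul, map_pow, h3, mul_inv_cancel₀ hy0]
    refine ⟨⟨(t : w.adicCompletion K), ?_⟩, ?_, ⟨((xCoord P * t ^ 2 : K) : w.adicCompletion K), ?_⟩,
      ⟨((yCoord P * t ^ 3 : K) : w.adicCompletion K), ?_⟩, ?_, ?_, ?_, ?_⟩
    · rw [HeightOneSpectrum.mem_adicCompletionIntegers, hv]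
      exact ht.le
    · intro h0
      have h0' := congrArg (fun z : w.adicCompletionIntegers K => (z : w.adicCompletion K)) h0
      simp only [coe_eq_algebraMap, ZeroMemClass.coe_zero, map_eq_zero] at h0'
      exact ht0 h0'
    · rw [HeightOneSpectrum.mem_adicCompletionIntegers, hv, ha]
    · rw [HeightOneSpectrum.mem_adicCompletionIntegers, hv, hb]
    · exact isCoprime_of_valued_eq_one (by rw [hv, ha])
    · exact isCoprime_of_valued_eq_one (by rw [hv, hb])
    · simp only [coe_eq_algebraMap]
      rw [← map_pow, ← map_div₀, mul_div_cancel_right₀ _ (pow_ne_zero 2 ht0)]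
    · simp only [coe_eq_algebraMap]
      rw [← map_pow, ← map_div₀, mul_div_cancel_right₀ _ (pow_ne_zero 3 ht0)]
  · refine ⟨1, one_ne_zero, ⟨((xCoord P : K) : w.adicCompletion K), ?_⟩,
      ⟨((yCoord P : K) : w.adicCompletion K), ?_⟩, isCoprime_one_right, isCoprime_one_right, ?_, ?_⟩
    · rw [HeightOneSpectrum.mem_adicCompletionIntegers, hv]
      exact hx
    · rw [HeightOneSpectrum.mem_adicCompletionIntegers, hv]
      exact valuation_yCoord_le_one _ hP hx
    · simp
    · simp

theorem valued_localDenominator (w : HeightOneSpectrum (𝓞 K)) {P : (W⁄K).toAffine.Point}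
    (hP : P ≠ 0) : Valued.v (localDenominator w P) = denominatorValuation w P := by
  have h := exists_isLocalDenominator (w := w) hP
  rw [localDenominator, dif_pos h]
  exact valued_eq_denominatorValuation hP h.choose_spec

theorem denominatorValuation_sq (w : HeightOneSpectrum (𝓞 K)) {P : (W⁄K).toAffine.Point}
    (hP : P ≠ 0) : denominatorValuation w P ^ 2 * max 1 (w.valuation K (xCoord P)) = 1 := by
  rw [denominatorValuation]
  split_ifs with h
  · rw [max_eq_right h.le, valuation_param_sq _ hP h, inv_mul_cancel₀ (zero_lt_one.trans h).ne']
  · rw [max_eq_left (not_lt.1 h), one_pow, one_mul]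

end LocalDenominator

/-! ### The denominator ideal and its generator -/

section GlobalDenominator

variable {K : Type*} [Field K] [NumberField K] {W : WeierstrassCurve ℤ}

/-- Elements of the denominator ideal vanish at `v` at least to the pole order of `x`. -/
theorem intValuation_mul_max_le_one (v : HeightOneSpectrum (𝓞 K)) {x : K} {r : 𝓞 K}
    (hr : r ∈ denominatorIdeal x) : v.intValuation r * max 1 (v.valuation K x) ≤ 1 := by
  obtain ⟨s, hs⟩ := hr
  rcases max_choice 1 (v.valuation K x) with h | h
  · rw [h, mul_one]
    exact v.intValuation_le_one r
  · rw [h, ← v.valuation_of_algebraMap (K := K), ← map_mul, hs]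
    exact v.valuation_le_one s

/-- Some element of the denominator ideal vanishes at `v` exactly to the pole order of `x`: multiply
a power of a uniformizer by an element prime to `v` that clears the other denominators of `x`. -/
theorem exists_mem_denominatorIdeal (v : HeightOneSpectrum (𝓞 K)) (x : K) :
    ∃ r ∈ denominatorIdeal x, v.intValuation r * max 1 (v.valuation K x) = 1 := by
  obtain ⟨ϖ, hϖ⟩ := v.intValuation_exists_uniformizer
  -- `m` is the order of the pole of `x` at `v`, or `0` if there is none.
  obtain ⟨m, hm⟩ : ∃ m : ℕ, max 1 (v.valuation K x) = WithZero.exp (m : ℤ) := by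
    rcases le_total (v.valuation K x) 1 with h | h
    · exact ⟨0, by simp [h]⟩
    · have h0 : v.valuation K x ≠ 0 := (zero_lt_one.trans_le h).ne'
      rw [max_eq_right h, ← WithZero.exp_log h0]
      have : 0 ≤ WithZero.log (v.valuation K x) := by
        rw [← WithZero.exp_le_exp, WithZero.exp_log h0]
        simpa using h
      exact ⟨_, congrArg _ (Int.toNat_of_nonneg this).symm⟩
  have hϖm : v.intValuation (ϖ ^ m) * WithZero.exp (m : ℤ) = 1 := by
    rw [map_pow, hϖ, ← WithZero.exp_nsmul, ← WithZero.exp_add]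
    simp
  have hint : v.valuation K (x * algebraMap (𝓞 K) K (ϖ ^ m)) ≤ 1 := by
    rw [map_mul, v.valuation_of_algebraMap, mul_comm, ← hϖm]
    gcongr
    exact hm ▸ le_max_right _ _
  obtain ⟨n, s, hs⟩ := v.exists_primeCompl_mul_eq_of_integer _ hint
  refine ⟨ϖ ^ m * s, ⟨n, ?_⟩, ?_⟩
  · refine Eq.trans ?_ hs
    rw [RingOfIntegers.coe_eq_algebraMap, map_mul]
    ring
  · rw [map_mul, (v.intValuation_eq_one_iff_mem_primeCompl s).2 s.2, mul_one, hm, hϖm]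

theorem denominatorIdeal_ne_zero (v : HeightOneSpectrum (𝓞 K)) (x : K) :
    denominatorIdeal x ≠ 0 := by
  obtain ⟨r, hr, h⟩ := exists_mem_denominatorIdeal v x
  intro h0
  have : r = 0 := by simpa [h0] using hr
  simp [this] at h

open Classical in
/-- The exponent of `v` in the denominator ideal is the pole order of `x` at `v`. -/
theorem exp_count_denominatorIdeal (v : HeightOneSpectrum (𝓞 K)) (x : K) :
    WithZero.exp ((Associates.mk v.asIdeal).count
      (Associates.mk (denominatorIdeal x)).factors : ℤ) = max 1 (v.valuation K x) := by
  have hI := denominatorIdeal_ne_zero v x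
  obtain ⟨r, hr, h⟩ := exists_mem_denominatorIdeal v x
  have hpow : ∀ n : ℕ, n ≤ (Associates.mk v.asIdeal).count
      (Associates.mk (denominatorIdeal x)).factors ↔ denominatorIdeal x ≤ v.asIdeal ^ n := by
    intro n
    rw [← Associates.prime_pow_dvd_iff_le (Associates.mk_ne_zero.2 hI) v.associates_irreducible,
      ← Associates.mk_pow, Associates.mk_le_mk_iff_dvd, Ideal.dvd_iff_le]
  have hr0 : r ≠ 0 := by
    rintro rfl
    simp at h
  set k := (Associates.mk v.asIdeal).count (Associates.mk (Ideal.span {r})).factors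
  have hk : v.intValuation r = WithZero.exp (-(k : ℤ)) := v.intValuation_if_neg hr0
  have hmax : max 1 (v.valuation K x) = WithZero.exp (k : ℤ) := by
    rw [← inv_inj, ← eq_inv_of_mul_eq_one_left h, hk, WithZero.exp_neg]
  rw [hmax]
  congr 2
  refine le_antisymm ?_ ((hpow k).2 fun s hs => ?_)
  · have h1 := (hpow _).1 le_rfl hr
    rw [← v.intValuation_le_pow_iff_mem, hk, WithZero.exp_le_exp] at h1
    omega
  · rw [← v.intValuation_le_pow_iff_mem]
    have h2 := intValuation_mul_max_le_one v hs
    rwa [WithZero.exp_neg, ← one_div, le_div_iff₀ WithZero.exp_pos, ← hmax]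

theorem isGlobalDenominator_ne_zero {P : (W⁄K).toAffine.Point} {d : 𝓞 K}
    (hd : IsGlobalDenominator P d) : d ≠ 0 := by
  have h : Ideal.span {d} ≠ 0 := by
    rw [hd]
    exact finprod_induction (· ≠ 0) one_ne_zero (fun _ _ => mul_ne_zero)
      fun q => pow_ne_zero _ q.ne_bot
  rintro rfl
  exact h (by simp)

open Classical in
theorem count_span_of_isGlobalDenominator (v : HeightOneSpectrum (𝓞 K))
    {P : (W⁄K).toAffine.Point} {d : 𝓞 K} (hd : IsGlobalDenominator P d) :
    (Associates.mk v.asIdeal).count (Associates.mk (Ideal.span {d})).factors =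
      classNumber K * (Associates.mk v.asIdeal).count
        (Associates.mk (denominatorIdeal (xCoord P))).factors / 2 := by
  have hd0 : Ideal.span {d} ≠ 0 := by simpa using isGlobalDenominator_ne_zero hd
  have h1 := FractionalIdeal.count_coe K v hd0
  have h2 := FractionalIdeal.count_finprod K v (fun q => ((classNumber K *
    (Associates.mk q.asIdeal).count (Associates.mk (denominatorIdeal (xCoord P))).factors / 2 : ℕ) : ℤ))
    (by
      filter_upwards [Associates.finite_factors (denominatorIdeal_ne_zero v (xCoord P))] with q hq
      rw [Nat.cast_eq_zero] at hq
      simp [hq])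
  rw [hd, FractionalIdeal.coeIdeal_finprod _ K le_rfl] at h1
  simp only [FractionalIdeal.coeIdeal_pow] at h1
  simp only [zpow_natCast] at h2
  rw [← hd] at h1
  exact_mod_cast h1.symm.trans h2

/-- At every place the generator `d` has the valuation of the `h`-th power of a local denominator. -/
theorem valuation_of_isGlobalDenominator (v : HeightOneSpectrum (𝓞 K))
    {P : (W⁄K).toAffine.Point} (hP : P ≠ 0) {d : 𝓞 K} (hd : IsGlobalDenominator P d) :
    v.valuation K (d : K) = denominatorValuation v P ^ classNumber K := by
  classical
  have h1 := denominatorValuation_sq v hP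
  have h0 : denominatorValuation v P ≠ 0 := by
    intro h0
    simp [h0] at h1
  rw [← exp_count_denominatorIdeal] at h1
  obtain ⟨m, hm⟩ : ∃ m : ℤ, denominatorValuation v P = WithZero.exp m :=
    ⟨_, (WithZero.exp_log h0).symm⟩
  rw [v.valuation_of_algebraMap, v.intValuation_if_neg (isGlobalDenominator_ne_zero hd),
    count_span_of_isGlobalDenominator v hd]
  set n := (Associates.mk v.asIdeal).count (Associates.mk (denominatorIdeal (xCoord P))).factors
  rw [hm, ← WithZero.exp_nsmul, ← WithZero.exp_add, ← WithZero.exp_zero, WithZero.exp_inj] at h1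
  simp only [nsmul_eq_mul, Nat.cast_ofNat] at h1
  -- The exponent is even, so the division by `2` in the definition of `d` is exact.
  obtain ⟨k, hk⟩ : ∃ k : ℕ, n = 2 * k := ⟨n / 2, by omega⟩
  have hmk : m = -(k : ℤ) := by omega
  rw [hm, ← WithZero.exp_nsmul, hk, hmk, Nat.mul_left_comm, Nat.mul_div_cancel_left _ two_pos]
  simp

end GlobalDenominator

/-! ### The sum of the local heights -/

section LocalTerms

variable {K : Type*} [Field K] [NumberField K] {W : WeierstrassCurve ℤ} {p : ℕ} [Fact p.Prime]
  {v : HeightOneSpectrum (𝓞 K)}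

/-- An isomorphism `K_v ≃ ℚ_p` that identifies the rings of integers respects the ordering of
absolute values. -/
theorem valued_le_iff_norm_le {φ : v.adicCompletion K ≃+* ℚ_[p]}
    (hφ : ∀ x : v.adicCompletion K, Valued.v x ≤ 1 ↔ ‖φ x‖ ≤ 1) (x y : v.adicCompletion K) :
    Valued.v x ≤ Valued.v y ↔ ‖φ x‖ ≤ ‖φ y‖ := by
  rcases eq_or_ne y 0 with rfl | hy
  · simp
  · have h := hφ (x / y)
    have hy' : 0 < ‖φ y‖ := norm_pos_iff.2 ((map_ne_zero_iff _ φ.injective).2 hy)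
    rwa [map_div₀, map_div₀, norm_div, div_le_one₀ hy',
      div_le_one₀ (zero_lt_iff.2 ((Valuation.ne_zero_iff _).2 hy))] at h

theorem valued_sigmaAt {φ : v.adicCompletion K ≃+* ℚ_[p]}
    (hφ : ∀ x : v.adicCompletion K, Valued.v x ≤ 1 ↔ ‖φ x‖ ≤ 1)
    {P : (W⁄K).toAffine.Point} (hP : P ≠ 0) (hx : 1 < v.valuation K (xCoord P)) :
    Valued.v (sigmaAt φ P) = denominatorValuation v P := by
  have ht := valuation_param_lt_one _ hP hx
  have hv : Valued.v ((-xCoord P / yCoord P : K) : v.adicCompletion K) =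
      v.valuation K (xCoord P / yCoord P) := by
    rw [HeightOneSpectrum.adicCompletion.valued_coe, neg_div, Valuation.map_neg]
  have hlt : ‖φ ((-xCoord P / yCoord P : K) : v.adicCompletion K)‖ < 1 := by
    have := (valued_le_iff_norm_le hφ 1 ((-xCoord P / yCoord P : K) : v.adicCompletion K)).not
    rw [not_le, not_le, map_one, map_one, norm_one] at this
    exact this.1 (hv ▸ ht)
  have hn : ‖φ (sigmaAt φ P)‖ = ‖φ ((-xCoord P / yCoord P : K) : v.adicCompletion K)‖ := by
    rw [sigmaAt, RingEquiv.apply_symm_apply, norm_sigmaEval W p hlt]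
  rw [denominatorValuation, if_pos hx, ← hv]
  exact le_antisymm ((valued_le_iff_norm_le hφ _ _).2 hn.le)
    ((valued_le_iff_norm_le hφ _ _).2 hn.ge)

/-- As `E` is defined over `ℚ`, the conjugate of `σ_{π^c}(P)` is `σ_π(P^c)`. -/
theorem conjCompletion_sigmaAt [DecidableEq K] (c : K ≃ₐ[ℚ] K) {π : HeightOneSpectrum (𝓞 K)}
    (ψ : π.adicCompletion K ≃+* ℚ_[p]) (P : (W⁄K).toAffine.Point) :
    conjCompletion c π (sigmaAt ((conjCompletion c π).trans ψ) P) =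
      sigmaAt ψ (conjPoint c P) := by
  have h : c (-xCoord P / yCoord P) = -xCoord (conjPoint c P) / yCoord (conjPoint c P) := by
    cases P with
    | zero =>
      have h0 : conjPoint c (Affine.Point.zero : (W⁄K).toAffine.Point) = Affine.Point.zero := rfl
      rw [h0]
      simp [xCoord, yCoord]
    | some x y hxy => simp [xCoord, yCoord, conjPoint, Affine.Point.map_some]
  simp only [sigmaAt, RingEquiv.symm_trans_apply, RingEquiv.apply_symm_apply,
    RingEquiv.trans_apply, conjCompletion_coe, h]

theorem denominatorValuation_eq_one_of_valuation_le_one {P : (W⁄K).toAffine.Point}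
    (h : v.valuation K (xCoord P) ≤ 1) : denominatorValuation v P = 1 :=
  if_neg h.not_gt

/-- If each `α_w` generates the `w`-part of the inverse of the `h`-th power of the denominator of
`P`, then the product of the `α_w` generates the inverse of the ideal generated by `d`. -/
theorem finsum_conjLog_eq (c : K ≃ₐ[ℚ] K) {π : HeightOneSpectrum (𝓞 K)}
    (ψ : π.adicCompletion K ≃+* ℚ_[p])
    (hK2 : Module.finrank ℚ K = 2) (hK : IsTotallyComplex K) {P : (W⁄K).toAffine.Point}
    (hP : P ≠ 0) {d : 𝓞 K} (hd : IsGlobalDenominator P d)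
    (α : HeightOneSpectrum (𝓞 K) → K)
    (hα : ∀ w, w.valuation K (α w) * denominatorValuation w P ^ classNumber K = 1)
    (hα' : ∀ w v : HeightOneSpectrum (𝓞 K), v ≠ w → v.valuation K (α w) = 1) :
    (Function.support fun w => conjLog c ψ (α w)).Finite ∧
      ∑ᶠ w, conjLog c ψ (α w) = -conjLog c ψ (d : K) := by
  have hα0 : ∀ w, α w ≠ 0 := fun w h0 => by simpa [h0] using hα w
  have hd0 : (d : K) ≠ 0 := by exact_mod_cast isGlobalDenominator_ne_zero hd
  have hfin : {w : HeightOneSpectrum (𝓞 K) | 1 < w.valuation K (xCoord P)}.Finite :=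
    HeightOneSpectrum.Support.finite (𝓞 K) (xCoord P)
  -- Only the finitely many poles of `x(P)` contribute.
  have hone : ∀ w, w ∉ hfin.toFinset → ∀ v : HeightOneSpectrum (𝓞 K),
      v.valuation K (α w) = 1 := by
    intro w hw v
    rcases eq_or_ne v w with rfl | hv
    · have := hα v
      rwa [denominatorValuation_eq_one_of_valuation_le_one (by simpa using hw), one_pow,
        mul_one] at this
    · exact hα' w v hv
  have hsupp : (Function.support fun w => conjLog c ψ (α w)) ⊆ hfin.toFinset := by
    intro w hw
    by_contra hw'
    exact hw (conjLog_eq_zero c ψ hK2 hK (hone w hw'))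
  refine ⟨hfin.toFinset.finite_toSet.subset hsupp, ?_⟩
  rw [finsum_eq_sum_of_support_subset _ hsupp, ← conjLog_prod c ψ _ _ fun w _ => hα0 w,
    eq_neg_iff_add_eq_zero,
    ← conjLog_mul c ψ (Finset.prod_ne_zero_iff.2 fun w _ => hα0 w) hd0]
  refine conjLog_eq_zero c ψ hK2 hK fun v => ?_
  rw [map_mul, map_prod, valuation_of_isGlobalDenominator v hP hd]
  refine Eq.trans (congrArg (· * _) ?_) (hα v)
  exact Finset.prod_eq_single v (fun w _ hw => hα' w v hw.symm) fun hv => hone v hv v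

theorem mem_asIdeal_iff {ℓ : ℕ} {π π' : HeightOneSpectrum (𝓞 K)}
    (hπp : Ideal.span {(ℓ : 𝓞 K)} = π.asIdeal * π'.asIdeal) (w : HeightOneSpectrum (𝓞 K)) :
    (ℓ : 𝓞 K) ∈ w.asIdeal ↔ w = π ∨ w = π' := by
  have hmax : ∀ u : HeightOneSpectrum (𝓞 K), u.asIdeal ≤ w.asIdeal ↔ w = u := fun u =>
    ⟨fun h => HeightOneSpectrum.ext (u.isMaximal.eq_of_le w.isPrime.ne_top h).symm,
      fun h => h ▸ le_rfl⟩
  rw [← Ideal.span_singleton_le_iff_mem, hπp, w.isPrime.mul_le, hmax, hmax]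

/-- The formula for the sum of the local heights. The classes `α_w` of the local terms combine to
`d⁻¹`, and what remains of the terms above `p` are the values of the sigma function. -/
theorem localHeightSum_anticycChar [DecidableEq K] (c : K ≃ₐ[ℚ] K) {π : HeightOneSpectrum (𝓞 K)}
    (ψ : π.adicCompletion K ≃+* ℚ_[p])
    (hψ : ∀ x : π.adicCompletion K, Valued.v x ≤ 1 ↔ ‖ψ x‖ ≤ 1)
    (hK2 : Module.finrank ℚ K = 2) (hK : IsTotallyComplex K) (hπ : conjPrime c π ≠ π)
    (hπp : Ideal.span {(p : 𝓞 K)} = π.asIdeal * (conjPrime c π).asIdeal)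
    {P : (W⁄K).toAffine.Point} (hP : P ≠ 0)
    (hP0 : ∀ v : HeightOneSpectrum (𝓞 K), (p : 𝓞 K) ∈ v.asIdeal → ReducesToZero v P)
    {d : 𝓞 K} (hd : IsGlobalDenominator P d) :
    localHeightSum c ψ (anticycChar p c π ψ) P =
      1 / (p : ℚ_[p]) * padicLog p (ψ (sigmaAt ψ P / sigmaAt ψ (conjPoint c P))) +
      1 / ((classNumber K : ℚ_[p]) * p) *
        padicLog p (ψ (((c (d : K) / (d : K) : K) : π.adicCompletion K))) := by
  have hmem := mem_asIdeal_iff hπp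
  have hψc : ∀ x : (conjPrime c π).adicCompletion K,
      Valued.v x ≤ 1 ↔ ‖((conjCompletion c π).trans ψ) x‖ ≤ 1 := fun x => by
    rw [← valued_conjCompletion, hψ, RingEquiv.trans_apply]
  have hs := valued_sigmaAt hψ hP (hP0 π ((hmem π).2 (.inl rfl)) hP)
  have hsc := valued_sigmaAt hψc hP (hP0 _ ((hmem _).2 (.inr rfl)) hP)
  have hne : ∀ w, denominatorValuation w P ≠ 0 := fun w h0 => by
    simpa [h0] using denominatorValuation_sq w hP
  have hld : ∀ w, localDenominator w P ≠ 0 := fun w => by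
    rw [← Valuation.ne_zero_iff Valued.v, valued_localDenominator w hP]
    exact hne w
  choose α hα using fun w => exists_trivializesAt (hld w)
  have hα1 : ∀ w, w.valuation K (α w) * denominatorValuation w P ^ classNumber K = 1 := fun w => by
    rw [← valued_localDenominator w hP]
    exact (hα w).1
  -- At the places above `p` the value of the sigma function has the valuation of a denominator.
  have htπ : TrivializesAt π (sigmaAt ψ P) (α π) := ⟨hs ▸ hα1 π, (hα π).2⟩
  have htc : TrivializesAt (conjPrime c π) (sigmaAt ((conjCompletion c π).trans ψ) P)
      (α (conjPrime c π)) := ⟨hsc ▸ hα1 _, (hα _).2⟩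
  obtain ⟨hfin, hsum⟩ := finsum_conjLog_eq c ψ hK2 hK hP hd α hα1 fun w => (hα w).2
  have hout : ∑ᶠ w : {w : HeightOneSpectrum (𝓞 K) // (p : 𝓞 K) ∉ w.asIdeal},
      localComponent (anticycChar p c π ψ) w.1 (localDenominator w.1 P) =
      1 / ((classNumber K : ℚ_[p]) * p) * ∑ᶠ w ∈ ({π, conjPrime c π}ᶜ : Set _),
        conjLog c ψ (α w) := by
    rw [finsum_subtype_eq_finsum_cond
      (f := fun w => localComponent (anticycChar p c π ψ) w (localDenominator w P))
      fun w : HeightOneSpectrum (𝓞 K) => (p : 𝓞 K) ∉ w.asIdeal, mul_finsum_mem]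
    refine finsum_congr fun w => ?_
    have hw : (p : 𝓞 K) ∉ w.asIdeal ↔ w ∈ ({π, conjPrime c π}ᶜ : Set _) := by
      rw [hmem]
      simp
    refine finsum_congr_Prop (propext hw) fun h => ?_
    have h' : ¬(w = π ∨ w = conjPrime c π) := h
    rw [not_or] at h'
    exact localComponent_anticycChar_of_ne c ψ hK2 hK (hα w) h'.1 h'.2
  have hsplit : ∑ᶠ w, conjLog c ψ (α w) = conjLog c ψ (α π) + conjLog c ψ (α (conjPrime c π)) +
      ∑ᶠ w ∈ ({π, conjPrime c π}ᶜ : Set _), conjLog c ψ (α w) := by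
    rw [← finsum_mem_pair (f := fun w => conjLog c ψ (α w)) hπ.symm]
    simpa [Set.compl_eq_univ_sdiff] using (finsum_mem_add_sdiff' (Set.subset_univ {π, conjPrime c π})
      (hfin.subset Set.inter_subset_right)).symm
  have hd0 : (d : K) ≠ 0 := by exact_mod_cast isGlobalDenominator_ne_zero hd
  have hlogd : padicLog p (ψ ((c (d : K) / (d : K) : K) : π.adicCompletion K)) =
      -conjLog c ψ (d : K) := by
    rw [conjLog, ← padicLog_inv (conjLog_arg_ne_zero c ψ hd0)]
    simp only [coe_eq_algebraMap]
    rw [← map_inv₀, ← map_inv₀, inv_div]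
  have hσ : ψ (sigmaAt ψ P) ≠ 0 := (map_ne_zero_iff _ ψ.injective).2 htπ.arg_ne_zero
  have hσc : ψ (sigmaAt ψ (conjPoint c P)) ≠ 0 := by
    rw [← conjCompletion_sigmaAt]
    exact (map_ne_zero_iff _ ψ.injective).2
      ((map_ne_zero_iff _ (conjCompletion c π).injective).2 htc.arg_ne_zero)
  have hh : (classNumber K : ℚ_[p]) ≠ 0 := Nat.cast_ne_zero.2 (classNumber_ne_zero K)
  have hp : (p : ℚ_[p]) ≠ 0 := Nat.cast_ne_zero.2 (Fact.out : p.Prime).ne_zero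
  rw [localHeightSum, localComponent_anticycChar_self c ψ hK2 hK htπ hπ,
    localComponent_anticycChar_conj c ψ hK2 hK htc hπ, conjCompletion_sigmaAt, hout, hlogd, ← hsum,
    hsplit, map_div₀, padicLog_div hσ hσc]
  field_simp
  ring

end LocalTerms

end AnticycHeight

end

open AnticycHeight in
theorem proposition2p4
    (W : WeierstrassCurve ℤ) (hW : IsGlobalMinimal W)
    (p : ℕ) [Fact p.Prime] (hp2 : p ≠ 2) (hp : IsGoodOrdinary W p)
    (K : Type*) [Field K] [NumberField K] [DecidableEq K]
    (hK2 : Module.finrank ℚ K = 2) (hK : IsTotallyComplex K)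
    (c : K ≃ₐ[ℚ] K) (hc : c ≠ AlgEquiv.refl)
    (π : HeightOneSpectrum (𝓞 K)) (hπ : conjPrime c π ≠ π)
    (hπp : Ideal.span {(p : 𝓞 K)} = π.asIdeal * (conjPrime c π).asIdeal)
    (ψ : π.adicCompletion K ≃+* ℚ_[p])
    (hψ : ∀ x : π.adicCompletion K, Valued.v x ≤ 1 ↔ ‖ψ x‖ ≤ 1)
    (P : (W⁄K).toAffine.Point) (hP : ¬ IsOfFinAddOrder P)
    (hP0 : ∀ v : HeightOneSpectrum (𝓞 K), (p : 𝓞 K) ∈ v.asIdeal → ReducesToZero v P)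
    (hPid : ∀ w : HeightOneSpectrum (𝓞 K), ReducesToIdentityComponent w P)
    (d : 𝓞 K) (hd : IsGlobalDenominator P d) :
    rhoHeight c ψ (anticycChar p c π ψ) P =
      1 / (p : ℚ_[p]) * padicLog p (ψ (sigmaAt ψ P / sigmaAt ψ (conjPoint c P))) +
      1 / ((classNumber K : ℚ_[p]) * p) *
        padicLog p (ψ (((c (d : K) / (d : K) : K) : π.adicCompletion K))) := by
  classical
  have hP1 : P ≠ 0 := by
    rintro rfl
    exact hP IsOfFinAddOrder.zero
  -- `P` is admissible, so the least admissible multiple used by `rhoHeight` is `1 • P`.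
  have h1 : 0 < 1 ∧ IsAdmissible p (1 • P) := by
    rw [one_smul]
    exact ⟨one_pos, hP1, hP0, hPid⟩
  have hex : ∃ m : ℕ, 0 < m ∧ IsAdmissible p (m • P) := ⟨1, h1⟩
  have hfind : Nat.find hex = 1 :=
    le_antisymm (Nat.find_min' hex h1) (Nat.find_spec hex).1
  rw [rhoHeight, dif_pos hex, ← localHeightSum_anticycChar c ψ hψ hK2 hK hπ hπp hP1 hP0 hd]
  have hone : 1 / ((1 : ℕ) : ℚ_[p]) ^ 2 * localHeightSum c ψ (anticycChar p c π ψ) (1 • P) =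
      localHeightSum c ψ (anticycChar p c π ψ) P := by
    rw [one_smul]
    simp
  rw [← hone, ← hfind]
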